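/- Let $m,n$ be positive integers with $n\ge 5$ and $\gcd(n,6)=\gcd(m,3)=\gcd(m,n)=1$, and let $C$ be the normalization of the projective closure of the affine curve $y^m=t^n+1$ over $\mathbb{Q}$. Let $l$ be a prime with $l\nmid mn$ and $l\ne 3$. Let $\mathcal{C}$ be the natural smooth projective model of $C$ over $\mathbb{Z}_{(l)}$ (the localization of $\mathbb Z$ at the prime $l$), that is, the normalization of $\mathbb{P}^1_{\mathbb{Z}_{(l)}}$ in the function field $\mathbb Q(C)$, with projection $\pi:\mathcal{C}\to\mathbb{P}^1_{\mathbb{Z}_{(l)}}$, $(y,t)\mapsto t$. Let $F:\mathbb{P}^1_{\mathbb{Z}_{(l)}}\to\mathbb{P}^1_{\mathbb{Z}_{(l)}}$ be the morphism $t\mapsto t^3$, let $f=F\circ\pi$, let $\Gamma_f\subset\mathcal{C}\times_{\mathbb{Z}_{(l)}}\mathbb{P}^1_{\mathbb{Z}_{(l)}}$ be the graph of $f$, and let $\mathcal{D}=(\mathrm{id}\times\pi)^*\Gamma_f\subset\mathcal{C}\times_{\mathbb{Z}_{(l)}}\mathcal{C}$. Then the reduction $D_l=\mathcal{D}\times_{\mathbb{Z}_{(l)}}\mathbb{F}_l$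 is an irreducible divisor, i.e. $D_l$ is an integral scheme (irreducible and reduced). -/

import Mathlib

open CategoryTheory CategoryTheory.Limits AlgebraicGeometry

noncomputable section

namespace CyclicCover

/-! ### The projective line over a ring, glued from two affine lines -/

/-- The affine line `Spec A[t]`. -/
abbrev affineLine (A : Type) [CommRing A] : Scheme.{0} :=
  Spec (CommRingCat.of (Polynomial A))

/-- The punctured affine line `Spec A[t, t⁻¹]`. -/
abbrev puncturedLine (A : Type) [CommRing A] : Scheme.{0} :=
  Spec (CommRingCat.of (LaurentPolynomial A))

/-- The inclusion of the punctured line in the affine line with coordinate `t`. -/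
def inclZero (A : Type) [CommRing A] : puncturedLine A ⟶ affineLine A :=
  Spec.map (CommRingCat.ofHom (Polynomial.toLaurent (R := A)))

/-- The inclusion of the punctured line in the affine line with coordinate `t⁻¹`. -/
def inclInfty (A : Type) [CommRing A] : puncturedLine A ⟶ affineLine A :=
  Spec.map (CommRingCat.ofHom
    ((LaurentPolynomial.invert (R := A)).toRingEquiv.toRingHom.comp
      (Polynomial.toLaurent (R := A))))

instance isOpenImmersion_inclZero (A : Type) [CommRing A] : IsOpenImmersion (inclZero A) :=
  IsOpenImmersion.of_isLocalization (R := Polynomial A) (S := LaurentPolynomial A) Polynomial.X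

instance isOpenImmersion_inclInfty (A : Type) [CommRing A] : IsOpenImmersion (inclInfty A) := by
  have h : inclInfty A = (Scheme.Spec.mapIso
      (LaurentPolynomial.invert (R := A)).toRingEquiv.toCommRingCatIso.op).hom ≫ inclZero A := by
    simp only [inclInfty, inclZero, CommRingCat.ofHom_comp, Spec.map_comp]
    rfl
  rw [h]
  infer_instance

/-- The projective line over `A`: two copies of the affine line, with coordinates `t` and `t⁻¹`,
glued along the punctured line. -/
def projLine (A : Type) [CommRing A] : Scheme.{0} :=
  pushout (inclZero A) (inclInfty A)

/-- The standard affine chart with coordinate `t`. -/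
def chartZero (A : Type) [CommRing A] : affineLine A ⟶ projLine A :=
  pushout.inl (inclZero A) (inclInfty A)

/-- The standard affine chart at the point `∞`, with coordinate `t⁻¹`. -/
def chartInfty (A : Type) [CommRing A] : affineLine A ⟶ projLine A :=
  pushout.inr (inclZero A) (inclInfty A)

lemma chart_condition (A : Type) [CommRing A] :
    inclZero A ≫ chartZero A = inclInfty A ≫ chartInfty A :=
  pushout.condition

/-- The structure morphism of the projective line over `A`. -/
def projLineToSpec (A : Type) [CommRing A] : projLine A ⟶ Spec (CommRingCat.of A) :=
  pushout.desc (Spec.map (CommRingCat.ofHom Polynomial.C))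
    (Spec.map (CommRingCat.ofHom Polynomial.C)) (by
      simp only [inclZero, inclInfty, ← Spec.map_comp, ← CommRingCat.ofHom_comp]
      congr 2
      ext a
      simp)

lemma chartZero_toSpec (A : Type) [CommRing A] :
    chartZero A ≫ projLineToSpec A = Spec.map (CommRingCat.ofHom Polynomial.C) :=
  pushout.inl_desc _ _ _

lemma chartInfty_toSpec (A : Type) [CommRing A] :
    chartInfty A ≫ projLineToSpec A = Spec.map (CommRingCat.ofHom Polynomial.C) :=
  pushout.inr_desc _ _ _

/-- The morphism `t ↦ t ^ k` of the affine line. -/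
def affineLinePow (A : Type) [CommRing A] (k : ℕ) : affineLine A ⟶ affineLine A :=
  Spec.map (CommRingCat.ofHom (Polynomial.expand A k).toRingHom)

/-- The morphism `t ↦ t ^ k` of the punctured line. -/
def puncturedLinePow (A : Type) [CommRing A] (k : ℕ) : puncturedLine A ⟶ puncturedLine A :=
  Spec.map (CommRingCat.ofHom (LaurentPolynomial.eval₂ (LaurentPolynomial.C (R := A))
    ((LaurentPolynomial.isUnit_T (R := A) (k : ℤ)).unit)))

lemma inclZero_pow (A : Type) [CommRing A] (k : ℕ) :
    puncturedLinePow A k ≫ inclZero A = inclZero A ≫ affineLinePow A k := by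
  simp only [puncturedLinePow, affineLinePow, inclZero, ← Spec.map_comp, ← CommRingCat.ofHom_comp]
  congr 2
  ext a <;> simp

lemma inclInfty_pow (A : Type) [CommRing A] (k : ℕ) :
    puncturedLinePow A k ≫ inclInfty A = inclInfty A ≫ affineLinePow A k := by
  simp only [puncturedLinePow, affineLinePow, inclInfty, ← Spec.map_comp,
    ← CommRingCat.ofHom_comp]
  congr 2
  ext a
  · simp
  · have h : ((LaurentPolynomial.isUnit_T (R := A) (k : ℤ)).unit⁻¹ : (LaurentPolynomial A)ˣ) =
        (LaurentPolynomial.isUnit_T (R := A) (-(k : ℤ))).unit := by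
      rw [inv_eq_iff_mul_eq_one]
      ext1
      rw [Units.val_mul, IsUnit.unit_spec, IsUnit.unit_spec, ← LaurentPolynomial.T_add,
        add_neg_cancel, LaurentPolynomial.T_zero, Units.val_one]
    simp [h]

/-- The morphism `t ↦ t ^ k` of the projective line over `A` to itself. -/
def projLinePow (A : Type) [CommRing A] (k : ℕ) : projLine A ⟶ projLine A :=
  pushout.desc (affineLinePow A k ≫ chartZero A) (affineLinePow A k ≫ chartInfty A) (by
    rw [← Category.assoc, ← Category.assoc, ← inclZero_pow, ← inclInfty_pow, Category.assoc,
      Category.assoc, chart_condition])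

lemma chartZero_projLinePow (A : Type) [CommRing A] (k : ℕ) :
    chartZero A ≫ projLinePow A k = affineLinePow A k ≫ chartZero A :=
  pushout.inl_desc _ _ _

lemma chartInfty_projLinePow (A : Type) [CommRing A] (k : ℕ) :
    chartInfty A ≫ projLinePow A k = affineLinePow A k ≫ chartInfty A :=
  pushout.inr_desc _ _ _

lemma projLinePow_toSpec (A : Type) [CommRing A] (k : ℕ) :
    projLinePow A k ≫ projLineToSpec A = projLineToSpec A := by
  refine pushout.hom_ext ?_ ?_
  · change chartZero A ≫ projLinePow A k ≫ projLineToSpec A = chartZero A ≫ projLineToSpec A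
    rw [← Category.assoc, chartZero_projLinePow, Category.assoc, chartZero_toSpec,
      affineLinePow, ← Spec.map_comp, ← CommRingCat.ofHom_comp]
    congr 2
    ext a
    simp
  · change chartInfty A ≫ projLinePow A k ≫ projLineToSpec A = chartInfty A ≫ projLineToSpec A
    rw [← Category.assoc, chartInfty_projLinePow, Category.assoc, chartInfty_toSpec,
      affineLinePow, ← Spec.map_comp, ← CommRingCat.ofHom_comp]
    congr 2
    ext a
    simp

instance isOpenImmersion_chartZero (A : Type) [CommRing A] : IsOpenImmersion (chartZero A) :=
  (Scheme.IsLocallyDirected.openCover (span (inclZero A) (inclInfty A))).map_prop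
    WalkingSpan.left

instance isOpenImmersion_chartInfty (A : Type) [CommRing A] : IsOpenImmersion (chartInfty A) :=
  (Scheme.IsLocallyDirected.openCover (span (inclZero A) (inclInfty A))).map_prop
    WalkingSpan.right

/-- The two standard charts cover the projective line. -/
lemma charts_cover (A : Type) [CommRing A] (x : projLine A) :
    x ∈ (chartZero A).opensRange ∨ x ∈ (chartInfty A).opensRange := by
  obtain ⟨i, y, hy⟩ :=
    Scheme.IsLocallyDirected.ι_jointly_surjective (span (inclZero A) (inclInfty A)) x
  rcases i with _ | _ | _
  · left
    refine ⟨inclZero A y, ?_⟩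
    rw [← hy, ← colimit.w (span (inclZero A) (inclInfty A)) WalkingSpan.Hom.fst]
    rfl
  · exact Or.inl ⟨y, hy⟩
  · exact Or.inr ⟨y, hy⟩

/-- The two standard charts meet in the punctured line. -/
lemma charts_inter (A : Type) [CommRing A] :
    ((chartZero A).opensRange ∩ (chartInfty A).opensRange : Set (projLine A)) =
      Set.range (inclZero A ≫ chartZero A) := by
  ext x
  constructor
  · rintro ⟨⟨y, hy⟩, ⟨z, hz⟩⟩
    obtain ⟨k, fi, fj, w, hw, -⟩ := (Scheme.IsLocallyDirected.ι_eq_ι_iff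
      (span (inclZero A) (inclInfty A)) (i := WalkingSpan.left) (j := WalkingSpan.right)
      (xi := y) (xj := z)).1 (hy.trans hz.symm)
    rcases k with _ | _ | _
    · refine ⟨w, ?_⟩
      rw [← hy, ← hw]
      have : fi = WalkingSpan.Hom.fst := Subsingleton.elim _ _
      subst this
      rfl
    · exact nomatch (show WalkingSpan.left ⟶ WalkingSpan.right from fj)
    · exact nomatch (show WalkingSpan.right ⟶ WalkingSpan.left from fi)
  · rintro ⟨w, rfl⟩
    refine ⟨⟨inclZero A w, rfl⟩, ⟨inclInfty A w, ?_⟩⟩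
    rw [chart_condition]
    rfl

instance quasiSeparatedSpace_projLine (A : Type) [CommRing A] :
    QuasiSeparatedSpace (projLine A) := by
  have hc : IsCompact
      ((chartZero A).opensRange ∩ (chartInfty A).opensRange : Set (projLine A)) := by
    rw [charts_inter]
    exact isCompact_range (inclZero A ≫ chartZero A).continuous
  refine Scheme.quasiSeparatedSpace_of_isOpenCover
    (fun b : Bool ↦ bif b then (chartZero A).opensRange else (chartInfty A).opensRange) ?_ ?_ ?_
  · refine TopologicalSpace.Opens.ext (Set.eq_univ_of_forall fun x ↦ ?_)
    rcases charts_cover A x with h | h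
    · exact TopologicalSpace.Opens.mem_iSup.2 ⟨true, h⟩
    · exact TopologicalSpace.Opens.mem_iSup.2 ⟨false, h⟩
  · rintro (_ | _)
    · exact isAffineOpen_opensRange (chartInfty A)
    · exact isAffineOpen_opensRange (chartZero A)
  · rintro (_ | _) (_ | _)
    · simpa using (isAffineOpen_opensRange (chartInfty A)).isCompact
    · simpa [Set.inter_comm] using hc
    · simpa using hc
    · simpa using (isAffineOpen_opensRange (chartZero A)).isCompact

/-! ### The curve and its model -/

/-- The coordinate ring `ℚ[t][y] / (y ^ m - (t ^ n + 1))` of the affine curve `y ^ m = t ^ n + 1`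
over `ℚ`. -/
abbrev affineCurveRing (m n : ℕ) : Type :=
  AdjoinRoot ((Polynomial.X : Polynomial (Polynomial ℚ)) ^ m -
    Polynomial.C ((Polynomial.X : Polynomial ℚ) ^ n + 1))

/-- The function field of the curve `C : y ^ m = t ^ n + 1` over `ℚ`. -/
abbrev curveFunctionField (m n : ℕ) : Type := FractionRing (affineCurveRing m n)

instance isPrime_span (l : ℕ) [hl : Fact l.Prime] : (Ideal.span {(l : ℤ)}).IsPrime :=
  (Ideal.span_singleton_prime (by exact_mod_cast hl.out.ne_zero)).2
    (Nat.prime_iff_prime_int.1 hl.out)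

/-- The localization `ℤ_(l)` of `ℤ` at the prime `l`. -/
abbrev ZLoc (l : ℕ) [Fact l.Prime] : Type := Localization.AtPrime (Ideal.span {(l : ℤ)})

/-- The inclusion of `ℤ_(l)` in `ℚ`. -/
def zLocToRat (l : ℕ) [Fact l.Prime] : ZLoc l →+* ℚ :=
  IsLocalization.lift (M := (Ideal.span {(l : ℤ)}).primeCompl) (g := Int.castRingHom ℚ) (by
    rintro ⟨y, hy⟩
    refine IsUnit.mk0 _ ?_
    intro h
    have h0 : y = 0 := by simpa using h
    exact hy (by rw [h0]; exact Ideal.zero_mem _))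

/-- The ring homomorphism `ℤ_(l)[t] → ℚ(C)`, `t ↦ t`. -/
def coordToFunctionField (m n l : ℕ) [Fact l.Prime] :
    Polynomial (ZLoc l) →+* curveFunctionField m n :=
  ((algebraMap (affineCurveRing m n) (curveFunctionField m n)).comp
    (AdjoinRoot.of ((Polynomial.X : Polynomial (Polynomial ℚ)) ^ m -
      Polynomial.C ((Polynomial.X : Polynomial ℚ) ^ n + 1)))).comp
    (Polynomial.mapRingHom (zLocToRat l))

/-- The morphism `t` from the generic point of `C` to the projective line over `ℤ_(l)`. -/
def genericPointToProjLine (m n l : ℕ) [Fact l.Prime] :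
    Spec (CommRingCat.of (curveFunctionField m n)) ⟶ projLine (ZLoc l) :=
  Spec.map (CommRingCat.ofHom (coordToFunctionField m n l)) ≫ chartZero (ZLoc l)

/-- The model `𝒞` over `ℤ_(l)` of the curve `C`: the normalization of the projective line over
`ℤ_(l)` in the function field of `C`. Its generic fibre is the normalization of a projective
closure of `y ^ m = t ^ n + 1`, and for `l ∤ m * n` it is smooth over `ℤ_(l)`. -/
def model (m n l : ℕ) [Fact l.Prime] : Scheme.{0} :=
  (genericPointToProjLine m n l).normalization

/-- The projection `π : 𝒞 ⟶ ℙ¹`, `(y, t) ↦ t`. -/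
def modelProj (m n l : ℕ) [Fact l.Prime] : model m n l ⟶ projLine (ZLoc l) :=
  (genericPointToProjLine m n l).fromNormalization

/-- The structure morphism of `𝒞`. -/
def modelToSpec (m n l : ℕ) [Fact l.Prime] :
    model m n l ⟶ Spec (CommRingCat.of (ZLoc l)) :=
  modelProj m n l ≫ projLineToSpec (ZLoc l)

/-! ### The divisor -/

/-- The morphism `f = F ∘ π : 𝒞 ⟶ ℙ¹` with `F : t ↦ t ^ 3`. -/
def cubeProj (m n l : ℕ) [Fact l.Prime] : model m n l ⟶ projLine (ZLoc l) :=
  modelProj m n l ≫ projLinePow (ZLoc l) 3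

lemma cubeProj_toSpec (m n l : ℕ) [Fact l.Prime] :
    cubeProj m n l ≫ projLineToSpec (ZLoc l) = modelToSpec m n l := by
  rw [cubeProj, Category.assoc, projLinePow_toSpec, modelToSpec]

/-- The graph `Γ_f`, as the closed immersion `(id, f) : 𝒞 ⟶ 𝒞 × ℙ¹` over `ℤ_(l)`. -/
def graphCube (m n l : ℕ) [Fact l.Prime] :
    model m n l ⟶ pullback (modelToSpec m n l) (projLineToSpec (ZLoc l)) :=
  pullback.lift (𝟙 _) (cubeProj m n l) (by rw [Category.id_comp, cubeProj_toSpec])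

/-- The morphism `id × π : 𝒞 × 𝒞 ⟶ 𝒞 × ℙ¹` over `ℤ_(l)`. -/
def idTimesProj (m n l : ℕ) [Fact l.Prime] :
    pullback (modelToSpec m n l) (modelToSpec m n l) ⟶
      pullback (modelToSpec m n l) (projLineToSpec (ZLoc l)) :=
  pullback.map _ _ _ _ (𝟙 _) (modelProj m n l) (𝟙 _) (by simp) (by simp [modelToSpec])

/-- The divisor `𝒟 = (id × π)^* Γ_f` on `𝒞 × 𝒞`, as a closed subscheme. -/
def divisorD (m n l : ℕ) [Fact l.Prime] : Scheme.{0} :=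
  pullback (idTimesProj m n l) (graphCube m n l)

/-- The inclusion of `𝒟` in `𝒞 × 𝒞`. -/
def divisorDι (m n l : ℕ) [Fact l.Prime] :
    divisorD m n l ⟶ pullback (modelToSpec m n l) (modelToSpec m n l) :=
  pullback.fst (idTimesProj m n l) (graphCube m n l)

/-- The structure morphism of `𝒟` over `ℤ_(l)`. -/
def divisorDToSpec (m n l : ℕ) [Fact l.Prime] :
    divisorD m n l ⟶ Spec (CommRingCat.of (ZLoc l)) :=
  divisorDι m n l ≫ pullback.fst (modelToSpec m n l) (modelToSpec m n l) ≫ modelToSpec m n l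

/-- The reduction `D_l` of `𝒟` modulo `l`: the fibre of `𝒟` over the closed point
`Spec 𝔽_l ⟶ Spec ℤ_(l)`. -/
def reductionD (m n l : ℕ) [Fact l.Prime] : Scheme.{0} :=
  pullback (divisorDToSpec m n l)
    (Spec.map (CommRingCat.ofHom (IsLocalRing.residue (ZLoc l))))

end CyclicCover

end

/-! The divisor is the fibre product of π and f over the projective line: pairs of points of the
curve whose coordinates satisfy t₂ = t₁³. Each standard chart is stable under t ↦ t³. In its
coordinate, the function field is generated over ℚ(t) by an m-th root of a(t) = t^e (t^n + 1), with
e = 0 at the origin and e = n(m - 1) at infinity. Write R = ℤ_(l)[t], B for its integral closure in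
ℚ(C), and k for the residue field. Over the chart, the reduction is the spectrum of Q = k[t] ⊗_R (B
⊗_R B), where the inner tensor product uses t ↦ t³ on the left factor.

Since m is invertible, splitting integral elements into components along the powers of the radical
shows that B is free over R, and that a^m B lies in R[y]
(`faithfullyFlat_and_exists_eval₂_of_radical`). Hence Q is torsion-free over k[t] and, after
multiplication by a nonzero polynomial, lies in the image of k[t][y₁, y₂] with y₁^m = a(t), y₂^m =
a(t³). So Q is a domain once this explicit ring is (`isDomain_tensorProduct_of_adjoin`).

For that ring (`isDomain_adjoinRoot_adjoinRoot`), the first radical is handled by Eisenstein at t =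
-1. For the second, since 3 ≠ 0 in k, there is a geometric point α with α^(3n) = -1 but α^n ≠ -1.
The first cover is unramified above α, so k[t][y₁] embeds in power series at α; there a(t³) has a
simple zero, and Eisenstein applies again.

The two integral charts share a point above t ≠ 0, so they glue to an integral scheme. -/

namespace CyclicCover

open Polynomial

/-! ### Irreducible binomials and the double radical extension over a field -/

/-- A binomial `X ^ m - b` is irreducible if some prime divides `b` exactly once. -/
lemma irreducible_X_pow_sub_C_of_prime {R : Type*} [CommRing R] [IsDomain R] {p b : R}
    (hp : Prime p) (hb : p ∣ b) (hb2 : ¬ p ^ 2 ∣ b) {m : ℕ} (hm : m ≠ 0) :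
    Irreducible (X ^ m - C b : R[X]) := by
  have hmonic : (X ^ m - C b : R[X]).Monic := monic_X_pow_sub_C b hm
  have hdeg : (X ^ m - C b : R[X]).degree = m := degree_X_pow_sub_C (Nat.pos_of_ne_zero hm) b
  refine irreducible_of_eisenstein_criterion (P := Ideal.span {p})
    ((Ideal.span_singleton_prime hp.ne_zero).2 hp) ?_ ?_ ?_ ?_ hmonic.isPrimitive
  · rw [hmonic.leadingCoeff, ← Ideal.eq_top_iff_one, Ideal.span_singleton_eq_top]
    exact hp.not_isUnit
  · intro j hj
    rw [hdeg] at hj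
    have hj : j < m := by exact_mod_cast hj
    rw [coeff_sub, coeff_X_pow, if_neg hj.ne, coeff_C, zero_sub, Ideal.mem_span_singleton, dvd_neg]
    split_ifs
    · exact hb
    · exact dvd_zero p
  · rw [hdeg]
    exact_mod_cast Nat.pos_of_ne_zero hm
  · rw [coeff_sub, coeff_X_pow, if_neg hm.symm, coeff_C_zero, zero_sub, neg_mem_iff,
      Ideal.span_singleton_pow, Ideal.mem_span_singleton]
    exact hb2

/-- The polynomial `t ^ e * (t ^ n + 1)`, whose `m`-th root generates the function field of the
curve, in the coordinate at either chart of the projective line. -/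
noncomputable def branchPoly (A : Type*) [CommRing A] (e n : ℕ) : A[X] := X ^ e * (X ^ n + 1)

lemma map_branchPoly {A B : Type*} [CommRing A] [CommRing B] (f : A →+* B) (e n : ℕ) :
    (branchPoly A e n).map f = branchPoly B e n := by
  simp [branchPoly]

lemma branchPoly_ne_zero (A : Type*) [CommRing A] [Nontrivial A] (e : ℕ) {n : ℕ} (hn : n ≠ 0) :
    branchPoly A e n ≠ 0 := by
  have h : (X ^ n + 1 : A[X]).Monic := monic_X_pow_add_C 1 hn
  exact ((monic_X_pow e).mul h).ne_zero

lemma expand_branchPoly (A : Type*) [CommRing A] (e n k : ℕ) :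
    expand A k (branchPoly A e n) = branchPoly A (k * e) (k * n) := by
  simp [branchPoly, pow_mul]

lemma eval_derivative_branchPoly {A : Type*} [CommRing A] (e n : ℕ) {x : A}
    (hx : x ^ n + 1 = 0) :
    (derivative (branchPoly A e n)).eval x = x ^ e * (n * x ^ (n - 1)) := by
  simp [branchPoly, hx, derivative_X_pow]

lemma eval_branchPoly {A : Type*} [CommRing A] (e n : ℕ) (x : A) :
    (branchPoly A e n).eval x = x ^ e * (x ^ n + 1) := by
  simp [branchPoly]

/-- As n is odd, -1 is a root of t^n + 1 over any base, and it is simple because n ≠ 0; Eisenstein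
applies at t + 1. -/
lemma irreducible_X_pow_sub_C_branchPoly (A : Type*) [CommRing A] [IsDomain A] (e : ℕ) {m n : ℕ}
    (hm : m ≠ 0) (hn : Odd n) (hnA : (n : A) ≠ 0) :
    Irreducible (X ^ m - C (branchPoly A e n) : A[X][X]) := by
  have h0 : (-1 : A) ^ n + 1 = 0 := by simp [hn.neg_one_pow]
  refine irreducible_X_pow_sub_C_of_prime (prime_X_sub_C (-1 : A)) ?_ ?_ hm
  · rw [dvd_iff_isRoot, IsRoot.def, eval_branchPoly, h0, mul_zero]
  · rintro ⟨q, hq⟩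
    have h1 := eval_derivative_branchPoly e n h0
    rw [hq] at h1
    have h2 : (n : A) = 0 := by
      have hu : IsUnit ((-1 : A) ^ e * (-1) ^ (n - 1)) := by
        exact (isUnit_one.neg.pow e).mul (isUnit_one.neg.pow _)
      refine (hu.mul_right_eq_zero).1 ?_
      rw [mul_assoc, mul_comm _ (n : A), ← h1]
      simp [derivative_pow]
    exact hnA h2

/-- Expansion of polynomials over `k` at a point of an extension of `k`. -/
noncomputable def expansionAt (k : Type*) {K : Type*} [CommRing k] [CommRing K] [Algebra k K]
    (α : K) : k[X] →+* PowerSeries K :=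
  Polynomial.coeToPowerSeries.ringHom.comp
    ((taylorAlgHom α).toRingHom.comp (mapRingHom (algebraMap k K)))

lemma expansionAt_apply {k K : Type*} [CommRing k] [CommRing K] [Algebra k K] (α : K) (p : k[X]) :
    expansionAt k α p = ((taylor α (p.map (algebraMap k K)) : K[X]) : PowerSeries K) := rfl

lemma expansionAt_injective {k K : Type*} [Field k] [Field K] [Algebra k K] (α : K) :
    Function.Injective (expansionAt k α) := by
  intro p q h
  rw [expansionAt_apply, expansionAt_apply, Polynomial.coe_inj] at h
  exact map_injective _ (algebraMap k K).injective (taylor_injective α h)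

/-- A power series over a field with nonzero constant coefficient an `m`-th power is an `m`-th
power, if `m` is invertible. -/
lemma exists_powerSeries_pow_eq {K : Type*} [Field K] {m : ℕ} (hm : (m : K) ≠ 0)
    (f : PowerSeries K) {β : K} (hβ : β ≠ 0) (hf : PowerSeries.constantCoeff f = β ^ m) :
    ∃ g : PowerSeries K, g ^ m = f := by
  have hm0 : m ≠ 0 := by rintro rfl; simp at hm
  -- Hensel's lemma lifts the approximate root β, at which the derivative m β^(m-1) is a unit.
  have hH : HenselianRing (PowerSeries K) (Ideal.span {PowerSeries.X}) := inferInstance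
  obtain ⟨g, hg, -⟩ := hH.is_henselian (X ^ m - C f) (monic_X_pow_sub_C f hm0)
    (PowerSeries.C β) (by
      rw [Ideal.mem_span_singleton, PowerSeries.X_dvd_iff]
      simp [hf]) (by
      apply IsUnit.map
      rw [PowerSeries.isUnit_iff_constantCoeff]
      simp [derivative_X_pow, hm, hβ])
  exact ⟨g, by simpa [sub_eq_zero] using hg⟩

/-- Over a domain, `AdjoinRoot` of a monic polynomial is a domain if it becomes irreducible over
some unique factorization domain containing the base. -/
lemma isDomain_adjoinRoot_of_irreducible_map {R O : Type*} [CommRing R] [CommRing O] [IsDomain O]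
    [UniqueFactorizationMonoid O] {ψ : R →+* O} (hψ : Function.Injective ψ) {f : R[X]}
    (hf : f.Monic) (hirr : Irreducible (f.map ψ)) : IsDomain (AdjoinRoot f) := by
  have hp : Prime (f.map ψ) := hirr.prime
  have hd : IsDomain (AdjoinRoot (f.map ψ)) := AdjoinRoot.isDomain_of_prime hp
  let φ : AdjoinRoot f →+* AdjoinRoot (f.map ψ) := AdjoinRoot.map ψ f (f.map ψ) dvd_rfl
  have hφ : Function.Injective φ := by
    rw [injective_iff_map_eq_zero]
    intro x hx
    obtain ⟨g, rfl⟩ := AdjoinRoot.mk_surjective x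
    have h1 : φ (AdjoinRoot.mk f g) = AdjoinRoot.mk (f.map ψ) (g.map ψ) := by
      refine (AdjoinRoot.lift_mk _ g).trans ?_
      rw [← eval₂_map, ← AdjoinRoot.aeval_eq (g.map ψ), aeval_def]
      rfl
    rw [h1, AdjoinRoot.mk_eq_zero] at hx
    rw [AdjoinRoot.mk_eq_zero]
    -- Remainders by a monic polynomial commute with the injective base change, so divisibility
    -- descends.
    rw [← modByMonic_eq_zero_iff_dvd hf]
    rw [← modByMonic_eq_zero_iff_dvd (hf.map ψ), ← map_modByMonic ψ hf] at hx
    exact (Polynomial.map_eq_zero_iff hψ).1 hx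
  exact hφ.isDomain φ

/-- Take for α^n a root w of w² - w + 1: then w³ = -1, while w = -1 would give 3 = 0. -/
lemma exists_pow_three_mul_add_one_eq_zero (K : Type*) [Field K] [IsAlgClosed K] {n : ℕ}
    (hn : n ≠ 0) (h3 : (3 : K) ≠ 0) :
    ∃ α : K, α ≠ 0 ∧ α ^ (3 * n) + 1 = 0 ∧ α ^ n + 1 ≠ 0 := by
  obtain ⟨w, hw⟩ := IsAlgClosed.exists_root (X ^ 2 - X + 1 : K[X]) (by
    have : (X ^ 2 - X + 1 : K[X]).degree = 2 := by compute_degree!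
    rw [this]; decide)
  have hw : w ^ 2 - w + 1 = 0 := by simpa using hw
  obtain ⟨α, hα⟩ := IsAlgClosed.exists_pow_nat_eq w (Nat.pos_of_ne_zero hn)
  have hw0 : w ≠ 0 := by rintro rfl; simp at hw
  refine ⟨α, ?_, ?_, ?_⟩
  · rintro rfl
    rw [zero_pow hn] at hα
    exact hw0 hα.symm
  · rw [mul_comm, pow_mul, hα]
    linear_combination (w + 1) * hw
  · rw [hα]
    intro h
    apply h3
    linear_combination hw - (w - 2) * h

/-- The ring obtained from `k[t]` by adjoining an `m`-th root of `branchPoly k e n` and then an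
`m`-th root of its image under `t ↦ t ^ 3` is a domain. -/
lemma isDomain_adjoinRoot_adjoinRoot (k : Type*) [Field k] (e : ℕ) {m n : ℕ} (hn : Odd n)
    (hmk : (m : k) ≠ 0) (hnk : (n : k) ≠ 0) (h3k : (3 : k) ≠ 0) :
    IsDomain (AdjoinRoot (X ^ m - C (AdjoinRoot.of (X ^ m - C (branchPoly k e n))
      (branchPoly k (3 * e) (3 * n))) : (AdjoinRoot (X ^ m - C (branchPoly k e n)))[X])) := by
  have hm : m ≠ 0 := by rintro rfl; simp at hmk
  have hn0 : n ≠ 0 := by rintro rfl; simp at hnk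
  set f : k[X][X] := X ^ m - C (branchPoly k e n) with hf
  have hfm : f.Monic := monic_X_pow_sub_C _ hm
  have hS : IsDomain (AdjoinRoot f) := AdjoinRoot.isDomain_of_prime
    (irreducible_X_pow_sub_C_branchPoly k e hm hn hnk).prime
  let K := AlgebraicClosure k
  have hc {j : ℕ} (hj : (j : k) ≠ 0) : (j : K) ≠ 0 := by
    intro h
    apply hj
    apply (algebraMap k K).injective
    simpa using h
  -- At α the second radicand vanishes and the first does not.
  obtain ⟨α, hα0, hα, hα1⟩ := exists_pow_three_mul_add_one_eq_zero K hn0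
    (by exact_mod_cast hc (j := 3) (by exact_mod_cast h3k))
  obtain ⟨β, hβ⟩ := IsAlgClosed.exists_pow_nat_eq ((branchPoly K e n).eval α)
    (Nat.pos_of_ne_zero hm)
  have hcc (p : k[X]) : PowerSeries.constantCoeff (expansionAt k α p) =
      (p.map (algebraMap k K)).eval α := by
    rw [expansionAt_apply, ← PowerSeries.coeff_zero_eq_constantCoeff_apply, Polynomial.coeff_coe,
      taylor_coeff_zero]
  have hβ0 : β ≠ 0 := by
    rintro rfl
    rw [zero_pow hm, eval_branchPoly] at hβ
    exact mul_ne_zero (pow_ne_zero e hα0) hα1 hβ.symm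
  -- The first radicand has an m-th root as a power series at α; sending the root there defines ψ.
  obtain ⟨g, hg⟩ := exists_powerSeries_pow_eq (hc hmk) (expansionAt k α (branchPoly k e n)) hβ0
    (by rw [hcc, map_branchPoly, hβ])
  let ψ : AdjoinRoot f →+* PowerSeries K := AdjoinRoot.lift (expansionAt k α) g (by
    simp [hf, hg])
  have hψof (p : k[X]) : ψ (AdjoinRoot.of f p) = expansionAt k α p := AdjoinRoot.lift_of _
  have hψ : Function.Injective ψ := by
    have : Module.Finite k[X] (AdjoinRoot f) := hfm.finite_adjoinRoot
    rw [RingHom.injective_iff_ker_eq_bot]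
    -- In a domain integral over k[t], a nonzero ideal meets k[t] nontrivially, so injectivity need
    -- only be tested on k[t].
    apply Ideal.eq_bot_of_comap_eq_bot (R := k[X])
    rw [eq_bot_iff]
    intro p hp
    rw [Ideal.mem_comap, RingHom.mem_ker, AdjoinRoot.algebraMap_eq, hψof] at hp
    exact (injective_iff_map_eq_zero _).1 (expansionAt_injective α) p hp
  refine isDomain_adjoinRoot_of_irreducible_map hψ (monic_X_pow_sub_C _ hm) ?_
  rw [Polynomial.map_sub, Polynomial.map_pow, map_X, map_C, hψof]
  -- The linear coefficient of the second radicand at α is, up to a power of α, the nonzero number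
  -- 3n: the zero is simple.
  refine irreducible_X_pow_sub_C_of_prime (p := PowerSeries.X) PowerSeries.X_prime ?_ ?_ hm
  · rw [PowerSeries.X_dvd_iff, hcc, map_branchPoly, eval_branchPoly, hα, mul_zero]
  · intro h
    rw [PowerSeries.X_pow_dvd_iff] at h
    have h1 := h 1 (by norm_num)
    rw [expansionAt_apply, Polynomial.coeff_coe, taylor_coeff_one, map_branchPoly,
      eval_derivative_branchPoly _ _ hα] at h1
    refine mul_ne_zero (pow_ne_zero _ hα0) (mul_ne_zero (hc ?_) (pow_ne_zero _ hα0)) h1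
    push_cast
    exact mul_ne_zero h3k hnk

/-! ### Domains by clearing denominators in tensor products -/

section

open TensorProduct

/-- If `Q` is torsion-free over a domain `P`, and an integral extension `Q₀` of `P` that is a
domain maps to `Q` with cokernel killed by a nonzero element of `P`, then `Q` is a domain. -/
lemma isDomain_of_smul_mem_range {P Q Q₀ : Type*} [CommRing P] [IsDomain P] [CommRing Q]
    [Nontrivial Q] [CommRing Q₀] [IsDomain Q₀] [Algebra P Q] [Algebra P Q₀] [Module.IsTorsionFree P Q]
    [Algebra.IsIntegral P Q₀] (ι : Q₀ →ₐ[P] Q) {h : P} (hh : h ≠ 0)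
    (hι : ∀ u : Q, h • u ∈ ι.range) : IsDomain Q := by
  have hinj : Function.Injective ι := by
    change Function.Injective ι.toRingHom
    rw [RingHom.injective_iff_ker_eq_bot]
    apply Ideal.eq_bot_of_comap_eq_bot (R := P)
    rw [eq_bot_iff]
    intro p hp
    have hp : algebraMap P Q p = 0 := by simpa [RingHom.mem_ker] using hp
    rw [Algebra.algebraMap_eq_smul_one] at hp
    exact (smul_eq_zero.1 hp).resolve_right one_ne_zero
  have : NoZeroDivisors Q := by
    -- If uv = 0, then hu and hv lift to elements of Q₀ with product zero; torsion-freeness then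
    -- removes h.
    refine ⟨fun {u v} huv ↦ ?_⟩
    obtain ⟨u', hu⟩ := hι u
    obtain ⟨v', hv⟩ := hι v
    have h1 : u' * v' = 0 := by
      apply hinj
      have hu : ι u' = h • u := hu
      have hv : ι v' = h • v := hv
      rw [map_mul, hu, hv, smul_mul_smul_comm, huv, smul_zero, map_zero]
    rcases mul_eq_zero.1 h1 with h2 | h2
    · left
      subst h2
      exact (smul_eq_zero.1 (hu.symm.trans (map_zero ι))).resolve_left hh
    · right
      subst h2
      exact (smul_eq_zero.1 (hv.symm.trans (map_zero ι))).resolve_left hh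
  exact NoZeroDivisors.to_isDomain Q

/-- A criterion for the reduction of a tensor product of two algebras that are, up to torsion,
generated by an `m`-th root to be a domain. -/
lemma isDomain_tensorProduct_of_adjoin {R₀ R₁ P B₁ B₂ : Type*} [CommRing R₀] [CommRing R₁]
    [CommRing P] [IsDomain P] [CommRing B₁] [CommRing B₂] [Algebra R₀ R₁] [Algebra R₁ P]
    [Algebra R₁ B₁] [Algebra R₀ B₁] [IsScalarTower R₀ R₁ B₁] [Algebra R₀ B₂]
    [Module.FaithfullyFlat R₁ B₁] [Module.FaithfullyFlat R₀ B₂]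
    {m : ℕ} (hm : m ≠ 0)
    {y₁ : B₁} {a₁ : R₁} (hy₁ : y₁ ^ m = algebraMap R₁ B₁ a₁)
    {y₂ : B₂} {a₀ : R₀} (hy₂ : y₂ ^ m = algebraMap R₀ B₂ a₀)
    {h₁ : R₁} (hh₁ : algebraMap R₁ P h₁ ≠ 0) (hB₁ : ∀ b : B₁, h₁ • b ∈ Algebra.adjoin R₁ {y₁})
    {h₀ : R₀} (hh₀ : algebraMap R₁ P (algebraMap R₀ R₁ h₀) ≠ 0)
    (hB₂ : ∀ b : B₂, h₀ • b ∈ Algebra.adjoin R₀ {y₂})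
    (hdom : IsDomain (AdjoinRoot (X ^ m - C (AdjoinRoot.of (X ^ m - C (algebraMap R₁ P a₁))
      (algebraMap R₁ P (algebraMap R₀ R₁ a₀))) :
        (AdjoinRoot (X ^ m - C (algebraMap R₁ P a₁)))[X]))) :
    IsDomain (P ⊗[R₁] (B₁ ⊗[R₀] B₂)) := by
  -- Flatness survives the base changes and yields the torsion-freeness over P.
  have hT : Module.FaithfullyFlat R₁ (B₁ ⊗[R₀] B₂) := .trans R₁ B₁ _
  have hQ : Module.FaithfullyFlat P (P ⊗[R₁] (B₁ ⊗[R₀] B₂)) := inferInstance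
  have hQn : Nontrivial (P ⊗[R₁] (B₁ ⊗[R₀] B₂)) := inferInstance
  have hQt : Module.IsTorsionFree P (P ⊗[R₁] (B₁ ⊗[R₀] B₂)) := inferInstance
  set f₁ : P[X] := X ^ m - C (algebraMap R₁ P a₁) with hf₁
  set f₂ : (AdjoinRoot f₁)[X] :=
    X ^ m - C (AdjoinRoot.of f₁ (algebraMap R₁ P (algebraMap R₀ R₁ a₀))) with hf₂
  have hfin₁ : Module.Finite P (AdjoinRoot f₁) := (monic_X_pow_sub_C _ hm).finite_adjoinRoot
  have hfin₂ : Module.Finite (AdjoinRoot f₁) (AdjoinRoot f₂) :=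
    (monic_X_pow_sub_C _ hm).finite_adjoinRoot
  have hfin : Module.Finite P (AdjoinRoot f₂) := .trans (AdjoinRoot f₁) _
  let incl₁ : B₁ →ₐ[R₁] P ⊗[R₁] (B₁ ⊗[R₀] B₂) :=
    Algebra.TensorProduct.includeRight.comp Algebra.TensorProduct.includeLeft
  let incl₂ : B₂ →+* P ⊗[R₁] (B₁ ⊗[R₀] B₂) :=
    (Algebra.TensorProduct.includeRight (R := R₁) (A := P) (B := B₁ ⊗[R₀] B₂)).toRingHom.comp
      (Algebra.TensorProduct.includeRight (R := R₀) (A := B₁) (B := B₂)).toRingHom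
  have hP₁ (r : R₁) : incl₁ (algebraMap R₁ B₁ r) = algebraMap P _ (algebraMap R₁ P r) := by
    rw [AlgHom.commutes, IsScalarTower.algebraMap_apply R₁ P]
  have hP₂ (r : R₀) : incl₂ (algebraMap R₀ B₂ r) =
      algebraMap P _ (algebraMap R₁ P (algebraMap R₀ R₁ r)) := by
    rw [← hP₁, ← IsScalarTower.algebraMap_apply R₀ R₁ B₁]
    simp only [incl₁, incl₂, RingHom.comp_apply, AlgHom.comp_apply, AlgHom.toRingHom_eq_coe,
      RingHom.coe_coe]
    congr 1
    rw [AlgHom.commutes]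
    exact Algebra.TensorProduct.algebraMap_apply _
  let ι₁ : AdjoinRoot f₁ →ₐ[P] P ⊗[R₁] (B₁ ⊗[R₀] B₂) :=
    AdjoinRoot.liftAlgHom f₁ (Algebra.ofId P _) (incl₁ y₁) (by
      rw [hf₁, eval₂_sub, eval₂_pow, eval₂_X, eval₂_C, ← map_pow, hy₁, hP₁]
      exact sub_self _)
  have hι₁ (p : P) : ι₁ (AdjoinRoot.of f₁ p) = algebraMap P _ p := ι₁.commutes p
  have hι₁r : ι₁ (AdjoinRoot.root f₁) = incl₁ y₁ := AdjoinRoot.liftAlgHom_root _ _ _ _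
  let ι₂ : AdjoinRoot f₂ →+* P ⊗[R₁] (B₁ ⊗[R₀] B₂) :=
    AdjoinRoot.lift ι₁.toRingHom (incl₂ y₂) (by
      rw [hf₂, eval₂_sub, eval₂_pow, eval₂_X, eval₂_C, ← map_pow, hy₂, hP₂]
      exact sub_eq_zero.2 (hι₁ _).symm)
  have hι₂ (s : AdjoinRoot f₁) : ι₂ (AdjoinRoot.of f₂ s) = ι₁ s := AdjoinRoot.lift_of _
  have hι₂r : ι₂ (AdjoinRoot.root f₂) = incl₂ y₂ := AdjoinRoot.lift_root _
  let ι : AdjoinRoot f₂ →ₐ[P] P ⊗[R₁] (B₁ ⊗[R₀] B₂) :=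
    { ι₂ with
      commutes' p := by
        change ι₂ (algebraMap P (AdjoinRoot f₂) p) = _
        rw [IsScalarTower.algebraMap_apply P (AdjoinRoot f₁) (AdjoinRoot f₂)]
        exact (hι₂ _).trans (ι₁.commutes p) }
  have hι (z) : ι z = ι₂ z := rfl
  have hadj₁ (b : B₁) (hb : b ∈ Algebra.adjoin R₁ {y₁}) : incl₁ b ∈ ι.range := by
    induction hb using Algebra.adjoin_induction with
    | mem x hx =>
      rw [Set.mem_singleton_iff] at hx
      subst hx
      exact ⟨AdjoinRoot.of f₂ (AdjoinRoot.root f₁), (hι₂ _).trans hι₁r⟩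
    | algebraMap r =>
      rw [hP₁]
      exact Subalgebra.algebraMap_mem _ _
    | add x y _ _ hx hy => rw [map_add]; exact add_mem hx hy
    | mul x y _ _ hx hy => rw [map_mul]; exact mul_mem hx hy
  have hadj₂ (b : B₂) (hb : b ∈ Algebra.adjoin R₀ {y₂}) : incl₂ b ∈ ι.range := by
    induction hb using Algebra.adjoin_induction with
    | mem x hx =>
      rw [Set.mem_singleton_iff] at hx
      subst hx
      exact ⟨AdjoinRoot.root f₂, hι₂r⟩
    | algebraMap r =>
      rw [hP₂]
      exact Subalgebra.algebraMap_mem _ _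
    | add x y _ _ hx hy => rw [map_add]; exact add_mem hx hy
    | mul x y _ _ hx hy => rw [map_mul]; exact mul_mem hx hy
  -- The factor from h₁ brings B₁ into the range, that from h₀ brings B₂; pure tensors then suffice
  -- by P-linearity.
  refine isDomain_of_smul_mem_range ι (mul_ne_zero hh₁ hh₀) fun u ↦ ?_
  have hpure (b : B₁) (b' : B₂) :
      (algebraMap R₁ P h₁ * algebraMap R₁ P (algebraMap R₀ R₁ h₀)) • (incl₁ b * incl₂ b') ∈
        ι.range := by
    have h := mul_mem (hadj₁ _ (hB₁ b)) (hadj₂ _ (hB₂ b'))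
    rwa [Algebra.smul_def, Algebra.smul_def, map_mul, map_mul, hP₁, hP₂, mul_mul_mul_comm,
      ← map_mul, ← Algebra.smul_def] at h
  induction u using TensorProduct.induction_on with
  | zero => rw [smul_zero]; exact zero_mem _
  | add x y hx hy => rw [smul_add]; exact add_mem hx hy
  | tmul p t =>
    induction t using TensorProduct.induction_on with
    | zero => rw [tmul_zero, smul_zero]; exact zero_mem _
    | add x y hx hy => rw [tmul_add, smul_add]; exact add_mem hx hy
    | tmul b b' =>
      have : p ⊗ₜ[R₁] (b ⊗ₜ[R₀] b') = p • (incl₁ b * incl₂ b') := by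
        simp [incl₁, incl₂, TensorProduct.smul_tmul']
      rw [this, smul_comm]
      exact Subalgebra.smul_mem _ (hpure b b') p

end

/-! ### Integral closure in a Kummer extension -/

/-- In a unique factorization domain, the elements whose `m`-th power divides `b` are the divisors
of a single element. -/
lemma exists_pow_dvd_iff_dvd {R : Type*} [CommRing R] [IsDomain R] [UniqueFactorizationMonoid R]
    {b : R} (hb : b ≠ 0) {m : ℕ} (hm : m ≠ 0) : ∃ d : R, ∀ q : R, q ^ m ∣ b ↔ q ∣ d := by
  -- Here d^m is a largest m-th power dividing b: its cofactor c is minimal for strict divisibility.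
  obtain ⟨c, ⟨d, hd⟩, hmin⟩ := (_root_.wellFounded_dvdNotUnit (α := R)).has_min
    {c | ∃ d, d ^ m * c = b} ⟨b, 1, by simp⟩
  have hd0 : d ≠ 0 := by
    rintro rfl
    rw [zero_pow hm, zero_mul] at hd
    exact hb hd.symm
  have hc0 : c ≠ 0 := by
    rintro rfl
    rw [mul_zero] at hd
    exact hb hd.symm
  refine ⟨d, fun q ↦ ⟨?_, fun h ↦ (pow_dvd_pow_of_dvd h m).trans (Dvd.intro _ hd)⟩⟩
  rintro ⟨s, hs⟩
  -- After removing the common factor g, q'^m divides c; a nonunit q' would contradict minimality.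
  obtain ⟨q', d', g, hrel, rfl, rfl⟩ := UniqueFactorizationMonoid.exists_reduced_factors' q d hd0
  have hg : g ≠ 0 := left_ne_zero_of_mul hd0
  have h1 : d' ^ m * c = q' ^ m * s := by
    apply mul_left_cancel₀ (pow_ne_zero m hg)
    rw [← mul_assoc, ← mul_assoc, ← mul_pow, ← mul_pow, hd, hs]
  obtain ⟨c', hc'⟩ : q' ^ m ∣ c := hrel.pow.dvd_of_dvd_mul_left (Dvd.intro _ h1.symm)
  by_cases hq : IsUnit q'
  · exact mul_dvd_mul_left g (hq.dvd)
  · refine absurd ?_ (hmin c' ⟨g * d' * q', ?_⟩)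
    · refine ⟨fun h ↦ hc0 (by rw [hc', h, mul_zero]), q' ^ m, ?_, by rw [hc', mul_comm]⟩
      rwa [isUnit_pow_iff hm]
    · rw [← hd, hc', mul_pow, mul_assoc]

section KummerComponents

variable {R K L : Type*} [CommRing R] [Field K] [Algebra R K] [Field L] [Algebra K L] [Algebra R L] [IsScalarTower R K L]

/-- The components of an integral element of a Kummer extension with respect to the powers of a
radical generator are integral. -/
lemma isIntegral_repr_smul_gen_pow (pb : PowerBasis K L) {a : K} {m : ℕ}
    (hmR : IsUnit (m : R)) (hdim : pb.dim = m) (ha : pb.gen ^ m = algebraMap K L a) {x : L}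
    (hx : _root_.IsIntegral R x) (i : Fin pb.dim) :
    _root_.IsIntegral R (pb.basis.repr x i • pb.gen ^ (i : ℕ)) := by
  have hm0 : m ≠ 0 := by
    rw [← hdim]
    exact pb.dim_ne_zero
  have hminpoly : minpoly K pb.gen = X ^ m - C a := by
    refine (minpoly.unique' K pb.gen (monic_X_pow_sub_C a hm0) (by simp [ha]) ?_).symm
    intro q hq
    rw [degree_X_pow_sub_C (Nat.pos_of_ne_zero hm0)] at hq
    by_contra! h
    have h1 := pb.dim_le_degree_of_root h.1 h.2
    rw [hdim] at h1
    exact absurd hq h1.not_gt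
  have hmL : (m : L) ≠ 0 := by
    rw [← map_natCast (algebraMap R L)]
    exact (hmR.map _).ne_zero
  have hmL' : NeZero (m : L) := ⟨hmL⟩
  obtain ⟨ζ, hζ⟩ := HasEnoughRootsOfUnity.exists_primitiveRoot (AlgebraicClosure L) m
  -- The embeddings multiply the radical generator by powers of ζ, so they act diagonally on its
  -- powers.
  let σ (j : ℕ) : L →ₐ[K] (AlgebraicClosure L) := pb.lift (ζ ^ j * algebraMap L (AlgebraicClosure L) pb.gen) (by
    rw [hminpoly]
    rw [map_sub, map_pow, aeval_X, aeval_C, mul_pow]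
    rw [← pow_mul, mul_comm j m, pow_mul, hζ.pow_eq_one, one_pow, one_mul, ← map_pow, ha,
      ← IsScalarTower.algebraMap_apply K L (AlgebraicClosure L), sub_self])
  have hσ (j : ℕ) (y : L) : σ j y = ∑ k : Fin pb.dim,
      ζ ^ (j * k) * algebraMap L (AlgebraicClosure L) (pb.basis.repr y k • pb.gen ^ (k : ℕ)) := by
    conv_lhs => rw [← pb.basis.sum_repr y]
    rw [map_sum]
    refine Finset.sum_congr rfl fun k _ ↦ ?_
    rw [map_smul, pb.basis_eq_pow, map_pow, pb.lift_gen, mul_pow, ← pow_mul, Algebra.smul_def,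
      Algebra.smul_def, map_mul, map_pow, ← IsScalarTower.algebraMap_apply K L (AlgebraicClosure L)]
    ring
  have hζint : _root_.IsIntegral R ζ := by
    refine _root_.IsIntegral.of_pow (Nat.pos_of_ne_zero hm0) ?_
    rw [hζ.pow_eq_one]
    exact isIntegral_one
  have hi : (i : ℕ) < m := hdim ▸ i.2
  -- Fourier inversion on the group of m-th roots of unity; the exponent m - i stands for -i.
  have hsum : ∑ j ∈ Finset.range m, ζ ^ (j * (m - i)) * σ j x =
      (m : (AlgebraicClosure L)) * algebraMap L (AlgebraicClosure L) (pb.basis.repr x i • pb.gen ^ (i : ℕ)) := by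
    refine (Finset.sum_congr rfl fun j _ ↦ by rw [hσ, Finset.mul_sum]).trans ?_
    rw [Finset.sum_comm, Finset.sum_eq_single i]
    · have h1 (j : ℕ) : ζ ^ (j * (m - i)) * (ζ ^ (j * (i : ℕ)) *
          algebraMap L (AlgebraicClosure L) (pb.basis.repr x i • pb.gen ^ (i : ℕ))) =
          algebraMap L (AlgebraicClosure L) (pb.basis.repr x i • pb.gen ^ (i : ℕ)) := by
        rw [← mul_assoc, ← pow_add, ← mul_add, Nat.sub_add_cancel hi.le, mul_comm j m, pow_mul,
          hζ.pow_eq_one, one_pow, one_mul]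
      simp_rw [h1]
      simp
    · intro k _ hki
      have hk : (k : ℕ) < m := hdim ▸ k.2
      have h1 (j : ℕ) : ζ ^ (j * (m - i)) * (ζ ^ (j * (k : ℕ)) *
          algebraMap L (AlgebraicClosure L) (pb.basis.repr x k • pb.gen ^ (k : ℕ))) =
          (ζ ^ (m - i + k)) ^ j * algebraMap L (AlgebraicClosure L) (pb.basis.repr x k • pb.gen ^ (k : ℕ)) := by
        rw [← mul_assoc, ← pow_add, ← mul_add, ← pow_mul, mul_comm j]
      simp_rw [h1, ← Finset.sum_mul]
      -- The exponent lies strictly between 0 and 2m and differs from m, so the geometric sum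
      -- vanishes.
      have h2 : ζ ^ (m - i + k : ℕ) ≠ 1 := by
        rw [Ne, hζ.pow_eq_one_iff_dvd]
        rintro ⟨c, hc⟩
        apply hki
        apply Fin.ext
        have h3 : c < 2 := by
          by_contra! h
          have := Nat.mul_le_mul_left m h
          omega
        interval_cases c <;> omega
      have h3 := geom_sum_mul (ζ ^ (m - i + k : ℕ)) m
      rw [← pow_mul, mul_comm _ m, pow_mul, hζ.pow_eq_one, one_pow, sub_self] at h3
      rw [(mul_eq_zero.1 h3).resolve_right (sub_ne_zero.2 h2), zero_mul]
    · simp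
  have hint : _root_.IsIntegral R ((m : (AlgebraicClosure L)) *
      algebraMap L (AlgebraicClosure L) (pb.basis.repr x i • pb.gen ^ (i : ℕ))) := by
    rw [← hsum]
    refine _root_.IsIntegral.sum _ fun j _ ↦ (hζint.pow _).mul ?_
    exact hx.map ((σ j).restrictScalars R)
  obtain ⟨u, hu⟩ := hmR
  have h2 : algebraMap L (AlgebraicClosure L) (pb.basis.repr x i • pb.gen ^ (i : ℕ)) =
      algebraMap R (AlgebraicClosure L) (↑u⁻¹ : R) * ((m : (AlgebraicClosure L)) *
        algebraMap L (AlgebraicClosure L) (pb.basis.repr x i • pb.gen ^ (i : ℕ))) := by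
    rw [← mul_assoc, ← map_natCast (algebraMap R (AlgebraicClosure L)), ← hu, ← map_mul, Units.inv_mul, map_one,
      one_mul]
  have h3 : _root_.IsIntegral R (algebraMap L (AlgebraicClosure L) (pb.basis.repr x i • pb.gen ^ (i : ℕ))) := by
    rw [h2]
    exact isIntegral_algebraMap.mul hint
  exact (isIntegral_algebraMap_iff (algebraMap L (AlgebraicClosure L)).injective).1 h3

variable [IsDomain R] [UniqueFactorizationMonoid R] [IsFractionRing R K] (B : Type*) [CommRing B]
  [Algebra R B] [Algebra B L] [IsScalarTower R B L] [IsIntegralClosure B R L]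

/-- The integral closure of a unique factorization domain in a Kummer extension of its fraction
field, of degree invertible in the base, has a basis consisting of multiples of the powers of the
radical generator. -/
lemma exists_basis_integralClosure (pb : PowerBasis K L) {a : R} (ha0 : a ≠ 0) {m : ℕ}
    (hmR : IsUnit (m : R)) (hdim : pb.dim = m) (ha : pb.gen ^ m = algebraMap R L a) :
    ∃ (b : Module.Basis (Fin pb.dim) R B) (d : Fin pb.dim → R), ∀ i, d i ∣ a ^ m ∧
      algebraMap R L (d i) * algebraMap B L (b i) = pb.gen ^ (i : ℕ) := by
  have hm0 : m ≠ 0 := by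
    rw [← hdim]
    exact pb.dim_ne_zero
  have hinjL : Function.Injective (algebraMap R L) := by
    rw [IsScalarTower.algebraMap_eq R K L]
    exact (algebraMap K L).injective.comp (IsFractionRing.injective R K)
  have hinjB : Function.Injective (algebraMap B L) := IsIntegralClosure.algebraMap_injective B R L
  have haK : pb.gen ^ m = algebraMap K L (algebraMap R K a) := by
    rw [ha, IsScalarTower.algebraMap_apply R K L]
  -- The candidate basis is gen^i / d_i, with d_i the largest denominator that keeps the m-th power
  -- in R.
  choose d hd using fun i : Fin pb.dim ↦ exists_pow_dvd_iff_dvd (pow_ne_zero (i : ℕ) ha0) hm0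
  have hdd (i) : d i ^ m ∣ a ^ (i : ℕ) := (hd i (d i)).2 dvd_rfl
  have hd0 (i) : d i ≠ 0 := by
    intro h
    have h1 := hdd i
    rw [h, zero_pow hm0, zero_dvd_iff] at h1
    exact pow_ne_zero _ ha0 h1
  have hdL (i) : algebraMap R L (d i) ≠ 0 := (map_ne_zero_iff _ hinjL).2 (hd0 i)
  have hdK (i) : algebraMap R K (d i) ≠ 0 :=
    (map_ne_zero_iff _ (IsFractionRing.injective R K)).2 (hd0 i)
  have hint (i : Fin pb.dim) : _root_.IsIntegral R (pb.gen ^ (i : ℕ) / algebraMap R L (d i)) := by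
    refine _root_.IsIntegral.of_pow (Nat.pos_of_ne_zero hm0) ?_
    obtain ⟨s, hs⟩ := hdd i
    have : (pb.gen ^ (i : ℕ) / algebraMap R L (d i)) ^ m = algebraMap R L s := by
      rw [div_pow, ← pow_mul, mul_comm _ m, pow_mul, ha, ← map_pow, ← map_pow, hs, map_mul,
        mul_div_cancel_left₀ _ ((map_ne_zero_iff _ hinjL).2 (pow_ne_zero m (hd0 i)))]
    rw [this]
    exact isIntegral_algebraMap
  choose b hb using fun i ↦ (IsIntegralClosure.isIntegral_iff (A := B)).1 (hint i)
  have hbd (i) : algebraMap R L (d i) * algebraMap B L (b i) = pb.gen ^ (i : ℕ) := by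
    rw [hb, mul_div_cancel₀ _ (hdL i)]
  have hbK (i) : algebraMap B L (b i) =
      (Units.mk0 _ (inv_ne_zero (hdK i)) • ⇑pb.basis) i := by
    change _ = Units.mk0 _ (inv_ne_zero (hdK i)) • pb.basis i
    rw [hb, Units.smul_def, Units.val_mk0, pb.basis_eq_pow, Algebra.smul_def, map_inv₀,
      ← IsScalarTower.algebraMap_apply R K L, div_eq_inv_mul]
  have hli : LinearIndependent R b := by
    have h1 := (pb.basis.linearIndependent.units_smul
      fun i ↦ Units.mk0 _ (inv_ne_zero (hdK i))).restrict_scalars (R := R) (by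
        intro r s h
        apply IsFractionRing.injective R K
        simpa [Algebra.smul_def] using h)
    have h2 : (IsScalarTower.toAlgHom R B L).toLinearMap ∘ b =
        (fun i ↦ Units.mk0 _ (inv_ne_zero (hdK i))) • ⇑pb.basis := funext hbK
    rw [← h2] at h1
    exact h1.of_comp
  have hspan : ⊤ ≤ Submodule.span R (Set.range b) := by
    intro x _
    have hx : _root_.IsIntegral R (algebraMap B L x) :=
      IsIntegralClosure.isIntegral_iff.2 ⟨x, rfl⟩
    -- Integrality of c gen^i puts c^m a^i in R. For c = p/q reduced, q^m divides a^i, hence q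
    -- divides d_i.
    have hr (i) : ∃ r : R, algebraMap R K r = pb.basis.repr (algebraMap B L x) i * algebraMap R K (d i) := by
      have h1 := (isIntegral_repr_smul_gen_pow pb hmR hdim haK hx i).pow m
      set c := pb.basis.repr (algebraMap B L x) i with hc
      have h2 : (c • pb.gen ^ (i : ℕ)) ^ m =
          algebraMap K L (c ^ m * algebraMap R K (a ^ (i : ℕ))) := by
        rw [_root_.smul_pow, ← pow_mul, mul_comm _ m, pow_mul, haK, Algebra.smul_def, map_mul, map_pow,
          map_pow, map_pow]
      rw [h2] at h1
      have h1 := (isIntegral_algebraMap_iff (algebraMap K L).injective).1 h1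
      obtain ⟨s, hs⟩ := IsIntegrallyClosed.isIntegral_iff.1 h1
      obtain ⟨p, q, hpq, hc'⟩ := IsFractionRing.exists_reduced_fraction (A := R) c
      have hq0 : algebraMap R K q ≠ 0 := IsFractionRing.to_map_ne_zero_of_mem_nonZeroDivisors q.2
      have hc1 : c = algebraMap R K p / algebraMap R K q := by
        rw [← hc', IsFractionRing.mk'_eq_div]
      have h3 : (q : R) ^ m * s = p ^ m * a ^ (i : ℕ) := by
        apply IsFractionRing.injective R K
        rw [map_mul, hs, hc1, map_mul, map_pow, map_pow, map_pow, div_pow]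
        field_simp
      obtain ⟨t, ht⟩ := (hd i q).1 (hpq.symm.pow.dvd_of_dvd_mul_left (Dvd.intro _ h3))
      refine ⟨p * t, ?_⟩
      rw [hc1, ht, map_mul, map_mul]
      field_simp
    choose r hr using hr
    have hxr : x = ∑ i, r i • b i := by
      apply hinjB
      rw [map_sum]
      conv_lhs => rw [← pb.basis.sum_repr (algebraMap B L x)]
      refine Finset.sum_congr rfl fun i _ ↦ ?_
      rw [pb.basis_eq_pow, ← hbd, Algebra.smul_def, Algebra.smul_def, map_mul, ← mul_assoc,
        IsScalarTower.algebraMap_apply R K L, ← map_mul, ← hr,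
        ← IsScalarTower.algebraMap_apply R K L, ← IsScalarTower.algebraMap_apply R B L]
    rw [hxr]
    exact Submodule.sum_smul_mem _ _ fun i _ ↦ Submodule.subset_span (Set.mem_range_self i)
  refine ⟨Module.Basis.mk hli hspan, d, fun i ↦ ⟨?_, by rw [Module.Basis.mk_apply, hbd]⟩⟩
  have hi : (i : ℕ) < m := hdim ▸ i.2
  -- The chain d_i ∣ d_i^m ∣ a^i ∣ a^m gives one denominator for all basis vectors.
  exact (dvd_pow_self _ hm0).trans ((hdd i).trans (pow_dvd_pow a hi.le))

end KummerComponents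

/-- The integral closure of a unique factorization domain in the extension of its fraction field
by an `m`-th root `y` of an element `a`, with `m` invertible, is faithfully flat, and it agrees with
the subring generated by `y` up to multiplication by `a ^ m`. -/
lemma faithfullyFlat_and_exists_eval₂_of_radical {R L B : Type*} [CommRing R] [IsDomain R]
    [UniqueFactorizationMonoid R] [Field L] [CommRing B] {φ : R →+* L}
    (hφ : Function.Injective φ) {m : ℕ} (hmR : IsUnit (m : R)) {a : R}
    (ha0 : a ≠ 0) (hirr : Irreducible (X ^ m - C a)) {y : L} (hy : y ^ m = φ a)
    (hgen : ∀ F : Subfield L, (∀ r, φ r ∈ F) → y ∈ F → F = ⊤)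
    {β : R →+* B} {γ : B →+* L} (hβγ : γ.comp β = φ) (hγ : Function.Injective γ)
    (hint : ∀ x : L, φ.IsIntegralElem x ↔ x ∈ γ.range) :
    β.FaithfullyFlat ∧ ∃ z : B, z ^ m = β a ∧
      ∀ b : B, ∃ p : R[X], β (a ^ m) * b = p.eval₂ β z := by
  algebraize [β, γ, φ]
  have htower : IsScalarTower R B L := .of_algebraMap_eq' hβγ.symm
  have hclosure : IsIntegralClosure B R L := ⟨hγ, fun {x} ↦ hint x⟩
  have hm0 : m ≠ 0 := by rintro rfl; simp at hmR
  have hfaithful : FaithfulSMul R L := (faithfulSMul_iff_algebraMap_injective R L).2 hφ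
  let K := FractionRing R
  let : Algebra K L := FractionRing.liftAlgebra R L
  have htowerK : IsScalarTower R K L := inferInstance
  have hyK : y ^ m = algebraMap K L (algebraMap R K a) := by
    rw [hy, ← IsScalarTower.algebraMap_apply R K L]
    rfl
  have hirrK : Irreducible (X ^ m - C (algebraMap R K a)) := by
    have := ((monic_X_pow_sub_C a hm0).irreducible_iff_irreducible_map_fraction_map (K := K)).1 hirr
    simpa using this
  have hyint : _root_.IsIntegral K y :=
    ⟨X ^ m - C (algebraMap R K a), monic_X_pow_sub_C _ hm0, by simp [hyK]⟩
  have hminpoly : minpoly K y = X ^ m - C (algebraMap R K a) :=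
    (minpoly.eq_of_irreducible_of_monic hirrK (by simp [hyK]) (monic_X_pow_sub_C _ hm0)).symm
  have htop : Algebra.adjoin K {y} = ⊤ := by
    rw [← IntermediateField.adjoin_simple_toSubalgebra_of_isAlgebraic hyint.isAlgebraic,
      ← IntermediateField.top_toSubalgebra]
    congr 1
    rw [← IntermediateField.toSubfield_inj, IntermediateField.top_toSubfield]
    refine hgen _ (fun r ↦ ?_) (IntermediateField.mem_adjoin_simple_self K y)
    have h1 : φ r = algebraMap K L (algebraMap R K r) := by
      rw [← IsScalarTower.algebraMap_apply R K L]
      rfl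
    rw [h1]
    exact IntermediateField.algebraMap_mem _ _
  let pb : PowerBasis K L := PowerBasis.ofAdjoinEqTop' hyint htop
  have hpbgen : pb.gen = y := PowerBasis.ofAdjoinEqTop'_gen hyint htop
  have hpbdim : pb.dim = m := by
    rw [PowerBasis.ofAdjoinEqTop'_dim, hminpoly, natDegree_X_pow_sub_C]
  obtain ⟨b, d, hbd⟩ := exists_basis_integralClosure B pb ha0 hmR hpbdim
    (by rw [hpbgen, hy]; rfl)
  have hfree : Module.Free R B := Module.Free.of_basis b
  have hnontriv : Nontrivial B := γ.domain_nontrivial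
  refine ⟨(inferInstance : Module.FaithfullyFlat R B), ?_⟩
  obtain ⟨z, hz⟩ := (hint y).1 (by
    refine ⟨X ^ m - C a, monic_X_pow_sub_C a hm0, ?_⟩
    simp [hy])
  refine ⟨z, ?_, fun x ↦ ?_⟩
  · apply hγ
    rw [map_pow, hz, hy, ← hβγ]
    rfl
  · choose c hc using fun i ↦ (hbd i).1
    have hbi (i) : β (a ^ m) * b i = β (c i) * z ^ (i : ℕ) := by
      apply hγ
      rw [hc, map_mul, map_mul, map_mul, map_mul, map_pow, hz, ← hpbgen, ← (hbd i).2]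
      change γ (β (d i)) * γ (β (c i)) * γ (b i) = γ (β (c i)) * (φ (d i) * γ (b i))
      rw [← hβγ, RingHom.comp_apply]
      ring
    refine ⟨∑ i, C (b.repr x i * c i) * X ^ (i : ℕ), ?_⟩
    conv_lhs => rw [← b.sum_repr x]
    rw [eval₂_finsetSum, Finset.mul_sum]
    refine Finset.sum_congr rfl fun i _ ↦ ?_
    rw [eval₂_mul, eval₂_C, eval₂_pow, eval₂_X, map_mul, mul_assoc, ← hbi, Algebra.smul_def]
    change _ * (β _ * _) = _
    ring

/-! ### Pushout form of the domain criterion -/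

open TensorProduct in
/-- The reduction of the product of two faithfully flat algebras that agree with the algebras
generated by an `m`-th root up to torsion is a domain, if the corresponding polynomial algebra is. -/
lemma exists_isPushout_isDomain {R₀ R₁ P B₁ B₂ : Type} [CommRing R₀] [CommRing R₁]
    [CommRing P] [IsDomain P] [CommRing B₁] [CommRing B₂]
    (α : R₀ →+* R₁) (ρ : R₁ →+* P) {β₁ : R₁ →+* B₁} {β₂ : R₀ →+* B₂}
    (hβ₁ : β₁.FaithfullyFlat) (hβ₂ : β₂.FaithfullyFlat) {m : ℕ} (hm : m ≠ 0)
    {y₁ : B₁} {a₁ : R₁} (hy₁ : y₁ ^ m = β₁ a₁) {y₂ : B₂} {a₀ : R₀} (hy₂ : y₂ ^ m = β₂ a₀)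
    {h₁ : R₁} (hh₁ : ρ h₁ ≠ 0) (hB₁ : ∀ b : B₁, ∃ p : R₁[X], β₁ h₁ * b = p.eval₂ β₁ y₁)
    {h₀ : R₀} (hh₀ : ρ (α h₀) ≠ 0) (hB₂ : ∀ b : B₂, ∃ p : R₀[X], β₂ h₀ * b = p.eval₂ β₂ y₂)
    (hdom : IsDomain (AdjoinRoot (X ^ m - C (AdjoinRoot.of (X ^ m - C (ρ a₁))
      (ρ (α a₀))) : (AdjoinRoot (X ^ m - C (ρ a₁)))[X]))) :
    ∃ (T Q : CommRingCat.{0}) (i₁ : CommRingCat.of B₁ ⟶ T) (i₂ : CommRingCat.of B₂ ⟶ T)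
      (j₁ : CommRingCat.of P ⟶ Q) (j₂ : T ⟶ Q),
      IsPushout (CommRingCat.ofHom (β₁.comp α)) (CommRingCat.ofHom β₂) i₁ i₂ ∧
      IsPushout (CommRingCat.ofHom ρ) (CommRingCat.ofHom β₁ ≫ i₁) j₁ j₂ ∧ IsDomain Q ∧
      Function.Injective j₁.hom := by
  algebraize [α, ρ, β₁, β₂, β₁.comp α]
  refine ⟨.of (B₁ ⊗[R₀] B₂), .of (P ⊗[R₁] (B₁ ⊗[R₀] B₂)), _, _, _, _,
    CommRingCat.isPushout_tensorProduct R₀ B₁ B₂,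
    CommRingCat.isPushout_tensorProduct R₁ P (B₁ ⊗[R₀] B₂), ?_, ?_⟩
  swap
  · have hT : Module.FaithfullyFlat R₁ (B₁ ⊗[R₀] B₂) := .trans R₁ B₁ _
    exact FaithfulSMul.algebraMap_injective P (P ⊗[R₁] (B₁ ⊗[R₀] B₂))
  refine isDomain_tensorProduct_of_adjoin hm hy₁ hy₂ hh₁ (fun b ↦ ?_) hh₀ (fun b ↦ ?_) hdom
  · obtain ⟨p, hp⟩ := hB₁ b
    rw [Algebra.smul_def]
    change β₁ h₁ * b ∈ _
    rw [hp]
    exact aeval_mem_adjoin_singleton R₁ y₁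
  · obtain ⟨p, hp⟩ := hB₂ b
    rw [Algebra.smul_def]
    change β₂ h₀ * b ∈ _
    rw [hp]
    exact aeval_mem_adjoin_singleton R₀ y₂

/-! ### Normalization over an affine chart -/

/-- Over an affine open U the normalization is the spectrum of the integral closure of Γ(Y, U) in
Γ(X, f⁻¹U). Since f factors through j, f⁻¹U is all of X, and the description transports to R and L.
-/
lemma exists_isPullback_fromNormalization_of_iso {R L : CommRingCat.{0}} {X Y : Scheme.{0}}
    (eX : X ≅ Spec L) (φ : R ⟶ L) (j : Spec R ⟶ Y) [IsOpenImmersion j] (f : X ⟶ Y)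
    [QuasiCompact f] [QuasiSeparated f] (hf : f = eX.hom ≫ Spec.map φ ≫ j) (U : Y.affineOpens)
    (hUj : j.opensRange = U.1) :
    ∃ (B : CommRingCat.{0}) (β : R ⟶ B) (γ : B ⟶ L) (ι : Spec B ⟶ f.normalization),
      IsOpenImmersion ι ∧ IsPullback (Spec.map β) ι j f.fromNormalization ∧ β ≫ γ = φ ∧
      Function.Injective γ.hom ∧ ∀ x : L, φ.hom.IsIntegralElem x ↔ x ∈ γ.hom.range := by
  let : Algebra Γ(Y, U.1) Γ(X, f ⁻¹ᵁ U.1) := (f.app U.1).hom.toAlgebra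
  have hUimm : IsOpenImmersion U.2.fromSpec := IsAffineOpen.isOpenImmersion_fromSpec U.2
  let e := IsOpenImmersion.isoOfRangeEq j U.2.fromSpec (by
    rw [U.2.range_fromSpec, ← hUj]
    rfl)
  have he : e.inv ≫ j = U.2.fromSpec := IsOpenImmersion.isoOfRangeEq_inv_fac _ _ _
  have hX : IsAffine X := .of_isIso eX.hom
  have hU : f ⁻¹ᵁ U.1 = ⊤ := by
    rw [hf, Scheme.Hom.comp_preimage, Scheme.Hom.comp_preimage]
    rw [← hUj]
    simp
  have hfU := hU ▸ isAffineOpen_top X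
  have hfUiso : IsIso hfU.fromSpec := by
    have : Set.range hfU.fromSpec = Set.univ := by
      rw [hfU.range_fromSpec, hU]
      rfl
    have : Surjective hfU.fromSpec := ⟨Set.range_eq_univ.1 this⟩
    exact (isIso_iff_isOpenImmersion_and_surjective _).2 ⟨inferInstance, this⟩
  let B : CommRingCat.{0} := .of (integralClosure Γ(Y, U.1) Γ(X, f ⁻¹ᵁ U.1))
  let eR : R ⟶ Γ(Y, U.1) := Spec.preimage e.inv
  let eR' : Γ(Y, U.1) ⟶ R := Spec.preimage e.hom
  have heR : eR' ≫ eR = 𝟙 _ := by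
    apply Spec.map_injective
    simp [eR, eR']
  let eL : Γ(X, f ⁻¹ᵁ U.1) ⟶ L := Spec.preimage (eX.inv ≫ inv hfU.fromSpec)
  let eL' : L ⟶ Γ(X, f ⁻¹ᵁ U.1) := Spec.preimage (hfU.fromSpec ≫ eX.hom)
  have heL : eL ≫ eL' = 𝟙 _ := by
    apply Spec.map_injective
    simp [eL, eL']
  have heL' : eL' ≫ eL = 𝟙 _ := by
    apply Spec.map_injective
    simp [eL, eL']
  let val : B ⟶ Γ(X, f ⁻¹ᵁ U.1) :=
    CommRingCat.ofHom (integralClosure Γ(Y, U.1) Γ(X, f ⁻¹ᵁ U.1)).val.toRingHom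
  let dm : Γ(Y, U.1) ⟶ B :=
    CommRingCat.ofHom (algebraMap Γ(Y, U.1) (integralClosure Γ(Y, U.1) Γ(X, f ⁻¹ᵁ U.1)))
  have hdm : dm ≫ val = f.app U.1 := rfl
  have hφ : eR ≫ f.app U.1 ≫ eL = φ := by
    apply Spec.map_injective
    rw [← cancel_mono j, ← cancel_epi eX.hom, ← hf, Spec.map_comp, Spec.map_comp]
    simp only [eR, eL, Spec.map_preimage, Category.assoc]
    rw [he, Scheme.Hom.app_eq_appLE, U.2.SpecMap_appLE_fromSpec f hfU]
    simp
  have hinj : Function.Injective eL.hom := fun x y h ↦ by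
    have h1 := congr(eL'.hom $h)
    simpa [← CommRingCat.comp_apply, heL] using h1
  let ι : Spec B ⟶ f.normalization := f.normalizationOpenCover.f U
  have hι : IsOpenImmersion ι := f.normalizationOpenCover.map_prop U
  refine ⟨B, eR ≫ dm, val ≫ eL, ι, hι, ?_, ?_,
    hinj.comp Subtype.val_injective, fun x ↦ ⟨?_, ?_⟩⟩
  · refine IsOpenImmersion.isPullback _ _ _ _ ?_ ?_
    · refine (f.ι_fromNormalization U).trans ?_
      rw [Spec.map_comp, Category.assoc]
      simp only [eR, Spec.map_preimage]
      rw [he]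
      rfl
    · rw [hUj]
      exact f.fromNormalization_preimage U
  · rw [Category.assoc, reassoc_of% hdm, hφ]
  · rintro ⟨p, hp, hpx⟩
    have hx : _root_.IsIntegral Γ(Y, U.1) (eL' x) := by
      refine ⟨p.map eR.hom, hp.map _, hinj ?_⟩
      rw [Polynomial.eval₂_map, Polynomial.hom_eval₂, map_zero, ← hpx, ← hφ]
      congr 1
      exact congr($heL' x)
    exact ⟨⟨eL' x, hx⟩, congr($heL' x)⟩
  · rintro ⟨⟨z, p, hp, hpz⟩, rfl⟩
    refine ⟨p.map eR'.hom, hp.map _, ?_⟩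
    have h1 := congr(eL.hom $hpz)
    rw [Polynomial.hom_eval₂, map_zero] at h1
    rw [Polynomial.eval₂_map, ← CommRingCat.hom_comp, ← hφ, reassoc_of% heR]
    exact h1

/-- If a morphism `Spec L ⟶ Y` factors through an affine open chart `Spec R` of `Y`, then the
restriction of the normalization of `Y` in `Spec L` to this chart is the spectrum of the integral
closure of `R` in `L`. -/
lemma exists_isPullback_fromNormalization {R L : CommRingCat.{0}} {Y : Scheme.{0}} (φ : R ⟶ L)
    (j : Spec R ⟶ Y) [IsOpenImmersion j] (f : Spec L ⟶ Y) [QuasiCompact f] [QuasiSeparated f]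
    (hf : f = Spec.map φ ≫ j) :
    ∃ (B : CommRingCat.{0}) (β : R ⟶ B) (γ : B ⟶ L) (ι : Spec B ⟶ f.normalization),
      IsOpenImmersion ι ∧ IsPullback (Spec.map β) ι j f.fromNormalization ∧ β ≫ γ = φ ∧
      Function.Injective γ.hom ∧ ∀ x : L, φ.hom.IsIntegralElem x ↔ x ∈ γ.hom.range :=
  exists_isPullback_fromNormalization_of_iso (Iso.refl _) φ j f (by simpa using hf)
    ⟨j.opensRange, isAffineOpen_opensRange j⟩ rfl

/-! ### The ring ℤ_(l), and the function field in both coordinates -/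

instance isPrincipalIdealRing_zLoc (l : ℕ) [hl : Fact l.Prime] :
    IsPrincipalIdealRing (ZLoc l) := by
  have := IsLocalization.AtPrime.isDiscreteValuationRing_of_dedekind_domain ℤ
    (P := Ideal.span {(l : ℤ)})
    (by simpa [Ideal.span_singleton_eq_bot] using hl.out.ne_zero) (ZLoc l)
  infer_instance

lemma isUnit_natCast_zLoc {l : ℕ} [Fact l.Prime] {j : ℕ} (hj : ¬ l ∣ j) :
    IsUnit (j : ZLoc l) := by
  have h : (j : ℤ) ∈ (Ideal.span {(l : ℤ)}).primeCompl := by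
    rw [Ideal.mem_primeCompl_iff, Ideal.mem_span_singleton]
    exact_mod_cast hj
  have := IsLocalization.map_units (ZLoc l) (⟨j, h⟩ : (Ideal.span {(l : ℤ)}).primeCompl)
  simpa using this

lemma natCast_residueField_zLoc_ne_zero {l : ℕ} [Fact l.Prime] {j : ℕ} (hj : ¬ l ∣ j) :
    (j : IsLocalRing.ResidueField (ZLoc l)) ≠ 0 := by
  rw [← map_natCast (IsLocalRing.residue (ZLoc l))]
  exact ((isUnit_natCast_zLoc hj).map _).ne_zero

lemma zLocToRat_injective (l : ℕ) [Fact l.Prime] : Function.Injective (zLocToRat l) := by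
  refine (IsLocalization.lift_injective_iff _).2 fun x y ↦ ?_
  rw [(IsLocalization.injective (ZLoc l)
    (Ideal.primeCompl_le_nonZeroDivisors (Ideal.span {(l : ℤ)}))).eq_iff]
  simp

section FunctionField

variable (m n : ℕ)

/-- The coordinate `t` in the function field of the curve. -/
noncomputable def coordT : curveFunctionField m n :=
  algebraMap (affineCurveRing m n) (curveFunctionField m n) (AdjoinRoot.of _ X)

/-- The coordinate `y` in the function field of the curve. -/
noncomputable def coordY : curveFunctionField m n :=
  algebraMap (affineCurveRing m n) (curveFunctionField m n) (AdjoinRoot.root _)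

lemma coordY_pow : coordY m n ^ m = coordT m n ^ n + 1 := by
  have h := AdjoinRoot.eval₂_root ((X : ℚ[X][X]) ^ m - C ((X : ℚ[X]) ^ n + 1))
  rw [eval₂_sub, eval₂_pow, eval₂_X, eval₂_C, sub_eq_zero] at h
  rw [coordY, coordT, ← map_pow, h]
  simp

lemma coordToFunctionField_X (l : ℕ) [Fact l.Prime] :
    coordToFunctionField m n l X = coordT m n := by
  simp [coordToFunctionField, coordT]

variable {m} in
lemma polynomialToFunctionField_injective (hm : m ≠ 0) :
    Function.Injective ((algebraMap (affineCurveRing m n) (curveFunctionField m n)).comp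
      (AdjoinRoot.of _)) := by
  refine (IsFractionRing.injective (affineCurveRing m n) (curveFunctionField m n)).comp
    (AdjoinRoot.of.injective_of_degree_ne_zero ?_)
  rw [degree_X_pow_sub_C (Nat.pos_of_ne_zero hm)]
  exact_mod_cast hm

variable {m} in
lemma coordToFunctionField_injective (l : ℕ) [Fact l.Prime] (hm : m ≠ 0) :
    Function.Injective (coordToFunctionField m n l) :=
  (polynomialToFunctionField_injective n hm).comp (map_injective _ (zLocToRat_injective l))

variable {m} in
lemma coordT_ne_zero (hm : m ≠ 0) : coordT m n ≠ 0 :=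
  (map_ne_zero_iff _ (polynomialToFunctionField_injective n hm)).2 X_ne_zero

variable {m n} in
lemma isDomain_affineCurveRing (hm : m ≠ 0) (hn : Odd n) : IsDomain (affineCurveRing m n) := by
  have h := irreducible_X_pow_sub_C_branchPoly ℚ 0 hm hn (by exact_mod_cast hn.pos.ne')
  rw [branchPoly, pow_zero, one_mul] at h
  exact AdjoinRoot.isDomain_of_prime h.prime

variable [IsDomain (affineCurveRing m n)]

/-- A subfield contains ℚ automatically, so t and y generate; this supplies the generation
hypothesis on both charts. -/
lemma subfield_eq_top (F : Subfield (curveFunctionField m n)) (ht : coordT m n ∈ F)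
    (hy : coordY m n ∈ F) : F = ⊤ := by
  have h1 (p : ℚ[X]) : ((algebraMap (affineCurveRing m n) (curveFunctionField m n)).comp
      (AdjoinRoot.of _)) p ∈ F := by
    induction p using Polynomial.induction_on' with
    | add p q hp hq =>
      rw [map_add (RingHom.comp _ _)]
      exact add_mem hp hq
    | monomial k a =>
      rw [← C_mul_X_pow_eq_monomial, map_mul (RingHom.comp _ _), map_pow (RingHom.comp _ _)]
      refine mul_mem ?_ (pow_mem ht k)
      rw [← RingHom.comp_apply, eq_ratCast (RingHom.comp _ _)]
      exact SubfieldClass.ratCast_mem F a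
  have h2 (g : ℚ[X][X]) : ((algebraMap (affineCurveRing m n) (curveFunctionField m n)).comp
      (AdjoinRoot.mk _)) g ∈ F := by
    induction g using Polynomial.induction_on' with
    | add p q hp hq =>
      rw [map_add (RingHom.comp _ _)]
      exact add_mem hp hq
    | monomial k a =>
      rw [← C_mul_X_pow_eq_monomial, map_mul (RingHom.comp _ _), map_pow (RingHom.comp _ _)]
      exact mul_mem (h1 a) (pow_mem hy k)
  rw [eq_top_iff]
  intro x _
  obtain ⟨u, v, -, rfl⟩ := IsFractionRing.div_surjective (A := affineCurveRing m n) x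
  obtain ⟨p, rfl⟩ := AdjoinRoot.mk_surjective u
  obtain ⟨q, rfl⟩ := AdjoinRoot.mk_surjective v
  exact div_mem (h2 p) (h2 q)

variable (l : ℕ) [Fact l.Prime]

/-- The ring homomorphism `ℤ_(l)[s] → ℚ(C)`, `s ↦ t⁻¹`. -/
noncomputable def invCoordToFunctionField : Polynomial (ZLoc l) →+* curveFunctionField m n :=
  eval₂RingHom ((coordToFunctionField m n l).comp C) (coordT m n)⁻¹

lemma invCoordToFunctionField_X : invCoordToFunctionField m n l X = (coordT m n)⁻¹ := by
  simp [invCoordToFunctionField]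

lemma invCoordToFunctionField_injective (hm : m ≠ 0) :
    Function.Injective (invCoordToFunctionField m n l) := by
  rw [injective_iff_map_eq_zero]
  intro p hp
  have ht : (coordT m n)⁻¹ ≠ 0 := inv_ne_zero (coordT_ne_zero n hm)
  let : Invertible (coordT m n)⁻¹ := invertibleOfNonzero ht
  -- A relation for t⁻¹ becomes, on reversing coefficients, a relation for t.
  have h1 := (eval₂_reverse_eq_zero_iff ((coordToFunctionField m n l).comp C)
    (coordT m n)⁻¹ p).2 hp
  rw [invOf_eq_inv, inv_inv, ← coordToFunctionField_X m n l] at h1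
  have h2 : coordToFunctionField m n l p.reverse = 0 := by
    rw [← h1, ← hom_eval₂, eval₂_C_X]
  rw [map_eq_zero_iff _ (coordToFunctionField_injective n l hm)] at h2
  simpa using h2

/-- Since t is a unit in the function field, the generic point factors through the punctured line,
where the charts agree. -/
lemma genericPointToProjLine_eq_infty (hm : m ≠ 0) :
    genericPointToProjLine m n l =
      Spec.map (CommRingCat.ofHom (invCoordToFunctionField m n l)) ≫ chartInfty (ZLoc l) := by
  let ψ : LaurentPolynomial (ZLoc l) →+* curveFunctionField m n :=
    LaurentPolynomial.eval₂ ((coordToFunctionField m n l).comp C)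
      (Units.mk0 _ (coordT_ne_zero n hm))
  have h0 : coordToFunctionField m n l = ψ.comp toLaurent := by
    ext a
    · simp [ψ]
    · simp [ψ, coordToFunctionField_X]
  have h1 : invCoordToFunctionField m n l =
      ψ.comp ((LaurentPolynomial.invert (R := ZLoc l)).toRingEquiv.toRingHom.comp toLaurent) := by
    ext a
    · simp [ψ, invCoordToFunctionField]
    · simp [ψ, invCoordToFunctionField_X]
  rw [genericPointToProjLine, h0, h1, CommRingCat.ofHom_comp, CommRingCat.ofHom_comp,
    Spec.map_comp, Spec.map_comp, Category.assoc, Category.assoc]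
  congr 1
  exact chart_condition (ZLoc l)

end FunctionField

/-! ### The divisor as a fibre product over the projective line -/

section Reduction

variable (m n l : ℕ) [Fact l.Prime]

lemma idTimesProj_fst : idTimesProj m n l ≫ pullback.fst (modelToSpec m n l)
    (projLineToSpec (ZLoc l)) = pullback.fst (modelToSpec m n l) (modelToSpec m n l) :=
  (pullback.lift_fst _ _ _).trans (Category.comp_id _)

lemma idTimesProj_snd : idTimesProj m n l ≫ pullback.snd (modelToSpec m n l)
    (projLineToSpec (ZLoc l)) =
      pullback.snd (modelToSpec m n l) (modelToSpec m n l) ≫ modelProj m n l :=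
  pullback.lift_snd _ _ _

lemma graphCube_fst : graphCube m n l ≫ pullback.fst (modelToSpec m n l)
    (projLineToSpec (ZLoc l)) = 𝟙 _ :=
  pullback.lift_fst _ _ _

lemma graphCube_snd : graphCube m n l ≫ pullback.snd (modelToSpec m n l)
    (projLineToSpec (ZLoc l)) = cubeProj m n l :=
  pullback.lift_snd _ _ _

/-- Exhibits id × π as a base change of π; pasting with the graph turns the divisor into a fibre
product of π and f. -/
lemma isPullback_idTimesProj :
    IsPullback (pullback.snd (modelToSpec m n l) (modelToSpec m n l)) (idTimesProj m n l)
      (modelProj m n l) (pullback.snd (modelToSpec m n l) (projLineToSpec (ZLoc l))) := by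
  refine IsPullback.of_bot (t := (IsPullback.of_hasPullback (modelToSpec m n l)
    (projLineToSpec (ZLoc l))).flip) ?_ (idTimesProj_snd m n l).symm
  rw [idTimesProj_fst]
  exact (IsPullback.of_hasPullback _ _).flip

/-- The projection of `𝒟` to the first factor `𝒞`, through the graph of `f`. -/
noncomputable def divisorDToModel : divisorD m n l ⟶ model m n l :=
  pullback.snd (idTimesProj m n l) (graphCube m n l)

lemma isPullback_divisorDι : IsPullback (divisorDι m n l) (divisorDToModel m n l)
    (idTimesProj m n l) (graphCube m n l) :=
  IsPullback.of_hasPullback _ _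

/-- The divisor `𝒟` is the fibre product of `π` and `f` over the projective line. -/
lemma isPullback_divisorD :
    IsPullback (divisorDι m n l ≫ pullback.snd (modelToSpec m n l) (modelToSpec m n l))
      (divisorDToModel m n l) (modelProj m n l) (cubeProj m n l) := by
  have h := (isPullback_divisorDι m n l).paste_horiz (isPullback_idTimesProj m n l)
  rwa [graphCube_snd] at h

/-- The morphism from `𝒟` to the projective line given by `t` on the first factor. -/
noncomputable def divisorDToProjLine : divisorD m n l ⟶ projLine (ZLoc l) :=
  divisorDToModel m n l ≫ modelProj m n l

lemma divisorDToSpec_eq :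
    divisorDToSpec m n l = divisorDToProjLine m n l ≫ projLineToSpec (ZLoc l) := by
  have h : divisorDι m n l ≫ pullback.fst _ _ = divisorDToModel m n l := by
    rw [← idTimesProj_fst, (isPullback_divisorDι m n l).w_assoc, graphCube_fst, Category.comp_id]
  rw [divisorDToSpec, reassoc_of% h, divisorDToProjLine, Category.assoc, modelToSpec]

/-- The inclusion of the reduction of `𝒟` in `𝒟`. -/
noncomputable def reductionDι : reductionD m n l ⟶ divisorD m n l :=
  pullback.fst (divisorDToSpec m n l) _

/-- The structure morphism of the reduction of `𝒟` over the residue field. -/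
noncomputable def reductionDToSpec : reductionD m n l ⟶
    Spec (CommRingCat.of (IsLocalRing.ResidueField (ZLoc l))) :=
  pullback.snd (divisorDToSpec m n l) _

lemma isPullback_reductionDι : IsPullback (reductionDToSpec m n l) (reductionDι m n l)
    (Spec.map (CommRingCat.ofHom (IsLocalRing.residue (ZLoc l)))) (divisorDToSpec m n l) :=
  (IsPullback.of_hasPullback _ _).flip

/-- The morphism from the reduction of `𝒟` to the projective line over `ℤ_(l)`. -/
noncomputable def reductionDToProjLine : reductionD m n l ⟶ projLine (ZLoc l) :=
  reductionDι m n l ≫ divisorDToProjLine m n l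

lemma isPullback_polynomial {A B : Type} [CommRing A] [CommRing B] (f : A →+* B) :
    IsPullback (Spec.map (CommRingCat.ofHom (C : B →+* B[X])))
      (Spec.map (CommRingCat.ofHom (mapRingHom f))) (Spec.map (CommRingCat.ofHom f))
      (Spec.map (CommRingCat.ofHom (C : A →+* A[X]))) := by
  let := f.toAlgebra
  let := Polynomial.algebra A B
  exact isPullback_SpecMap_of_isPushout _ _ _ _ (CommRingCat.isPushout_of_isPushout A B A[X] B[X])

variable {m n l} in
/-- Over a chart of the projective line, the reduction of `𝒟` is a tensor product of rings. -/
lemma exists_isPullback_reductionDToProjLine {c : affineLine (ZLoc l) ⟶ projLine (ZLoc l)}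
    (hpow : c ≫ projLinePow (ZLoc l) 3 = affineLinePow (ZLoc l) 3 ≫ c)
    (hspec : c ≫ projLineToSpec (ZLoc l) = Spec.map (CommRingCat.ofHom C))
    {B T Q : CommRingCat.{0}} {β : CommRingCat.of (ZLoc l)[X] ⟶ B}
    {ι : Spec B ⟶ model m n l} (hB : IsPullback (Spec.map β) ι c (modelProj m n l))
    {i₁ i₂ : B ⟶ T}
    (hT : IsPushout (CommRingCat.ofHom (expand (ZLoc l) 3).toRingHom ≫ β) β i₁ i₂)
    {j₁ : CommRingCat.of (IsLocalRing.ResidueField (ZLoc l))[X] ⟶ Q} {j₂ : T ⟶ Q}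
    (hQ : IsPushout (CommRingCat.ofHom (mapRingHom (IsLocalRing.residue (ZLoc l)))) (β ≫ i₁)
      j₁ j₂) :
    ∃ v : Spec Q ⟶ reductionD m n l, IsPullback v (Spec.map (β ≫ i₁ ≫ j₂))
      (reductionDToProjLine m n l) c := by
  -- As t ↦ t³ preserves the chart, a point of the divisor whose first coordinate lies in it has its
  -- second there too; so one affine piece Spec T suffices.
  have hT' := (isPullback_SpecMap_of_isPushout _ _ _ _ hT).flip.paste_horiz hB.flip
  have h1 : Spec.map (CommRingCat.ofHom (expand (ZLoc l) 3).toRingHom ≫ β) ≫ c =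
      ι ≫ cubeProj m n l := by
    rw [cubeProj, ← reassoc_of% hB.w, hpow, Spec.map_comp, Category.assoc, affineLinePow]
  rw [h1] at hT'
  have hw := (IsPullback.of_right' hT' (isPullback_divisorD m n l)).paste_vert hB.flip
  set w := (isPullback_divisorD m n l).lift (Spec.map i₂ ≫ ι) (Spec.map i₁ ≫ ι)
    (by rw [hT'.w, Category.assoc])
  change IsPullback w _ (divisorDToProjLine m n l) c at hw
  -- Reducing the coordinate ring of the chart is the same as restricting to the closed point of
  -- Spec ℤ_(l).
  have hQ' := (isPullback_SpecMap_of_isPushout _ _ _ _ hQ).paste_horiz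
    (isPullback_polynomial (IsLocalRing.residue (ZLoc l)))
  have h2 : Spec.map (β ≫ i₁) ≫ Spec.map (CommRingCat.ofHom C) = w ≫ divisorDToSpec m n l := by
    rw [divisorDToSpec_eq, ← Category.assoc, hw.w, Category.assoc, hspec, Spec.map_comp]
  rw [h2] at hQ'
  have h3 := (IsPullback.of_right' hQ' (isPullback_reductionDι m n l)).paste_vert hw
  have h4 : Spec.map (β ≫ i₁ ≫ j₂) = Spec.map j₂ ≫ Spec.map i₁ ≫ Spec.map β := by
    rw [Spec.map_comp, Spec.map_comp, Category.assoc]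
  rw [h4]
  exact ⟨_, h3⟩

/-! ### Integrality on a chart, and gluing -/

/-- The reduction of the tensor product of two copies of an algebra generated, up to torsion, by
an `m`-th root of `branchPoly A e n`, with respect to `t ↦ t ^ 3` and `t ↦ t`, is a domain. -/
lemma exists_isPushout_isDomain_branchPoly {A k B : Type} [CommRing A] [Field k] [CommRing B]
    (ρ : A →+* k) {β : A[X] →+* B} (hβ : β.FaithfullyFlat) {e m n : ℕ} (hn : Odd n)
    (hmk : (m : k) ≠ 0) (hnk : (n : k) ≠ 0) (h3k : (3 : k) ≠ 0) {z : B}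
    (hz : z ^ m = β (branchPoly A e n))
    (hz' : ∀ b : B, ∃ p : A[X][X], β (branchPoly A e n ^ m) * b = p.eval₂ β z) :
    ∃ (T Q : CommRingCat.{0}) (i₁ : CommRingCat.of B ⟶ T) (i₂ : CommRingCat.of B ⟶ T)
      (j₁ : CommRingCat.of k[X] ⟶ Q) (j₂ : T ⟶ Q),
      IsPushout (CommRingCat.ofHom (β.comp (expand A 3).toRingHom)) (CommRingCat.ofHom β) i₁ i₂ ∧
      IsPushout (CommRingCat.ofHom (mapRingHom ρ)) (CommRingCat.ofHom β ≫ i₁) j₁ j₂ ∧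
      IsDomain Q ∧ Function.Injective j₁.hom := by
  have hm0 : m ≠ 0 := by rintro rfl; simp at hmk
  have hn0 : n ≠ 0 := by rintro rfl; simp at hnk
  have hρ : mapRingHom ρ (branchPoly A e n) = branchPoly k e n := map_branchPoly _ _ _
  have hρ' : mapRingHom ρ ((expand A 3).toRingHom (branchPoly A e n)) =
      branchPoly k (3 * e) (3 * n) := by
    change mapRingHom _ (expand A 3 (branchPoly A e n)) = _
    rw [expand_branchPoly]
    exact map_branchPoly _ _ _
  refine exists_isPushout_isDomain (expand A 3).toRingHom (mapRingHom ρ) hβ hβ hm0 hz hz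
    (h₁ := branchPoly A e n ^ m) ?_ hz' (h₀ := branchPoly A e n ^ m) ?_ hz' ?_
  · rw [map_pow, hρ]
    exact pow_ne_zero _ (branchPoly_ne_zero k _ hn0)
  · rw [map_pow, map_pow, hρ']
    exact pow_ne_zero _ (branchPoly_ne_zero k _ (by omega))
  · rw [hρ, hρ']
    exact isDomain_adjoinRoot_adjoinRoot k e hn hmk hnk h3k

/-- Over a chart of the projective line in whose coordinate the function field is generated by an
`m`-th root of `branchPoly e n`, the reduction of `𝒟` is integral and dominates the line. -/
lemma exists_isIntegral_openImmersion_reductionD [IsDomain (affineCurveRing m n)] (hn : Odd n)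
    (hln : ¬ l ∣ n) (hlm : ¬ l ∣ m) (hl3 : ¬ l ∣ 3)
    {c : affineLine (ZLoc l) ⟶ projLine (ZLoc l)} [IsOpenImmersion c]
    (hpow : c ≫ projLinePow (ZLoc l) 3 = affineLinePow (ZLoc l) 3 ≫ c)
    (hspec : c ≫ projLineToSpec (ZLoc l) = Spec.map (CommRingCat.ofHom C))
    {φ : (ZLoc l)[X] →+* curveFunctionField m n} (hφ : Function.Injective φ)
    (hc : genericPointToProjLine m n l = Spec.map (CommRingCat.ofHom φ) ≫ c)
    {e : ℕ} {y : curveFunctionField m n} (hy : y ^ m = φ (branchPoly (ZLoc l) e n))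
    (hgen : ∀ F : Subfield (curveFunctionField m n), (∀ r, φ r ∈ F) → y ∈ F → F = ⊤) :
    ∃ (V : Scheme.{0}) (v : V ⟶ reductionD m n l), IsIntegral V ∧ IsOpenImmersion v ∧
      Set.range v = (reductionDToProjLine m n l) ⁻¹' (Set.range c) ∧
      ∃ (x : V) (z : puncturedLine (ZLoc l)),
        (reductionDToProjLine m n l) (v x) = (inclZero (ZLoc l) ≫ c) z := by
  have hm0 : m ≠ 0 := by rintro rfl; simp at hlm
  have hn0 : n ≠ 0 := by rintro rfl; simp at hln
  have ha0 : branchPoly (ZLoc l) e n ≠ 0 := branchPoly_ne_zero _ e hn0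
  have hirr : Irreducible (X ^ m - C (branchPoly (ZLoc l) e n)) := by
    refine irreducible_X_pow_sub_C_branchPoly (ZLoc l) e hm0 hn ?_
    exact (isUnit_natCast_zLoc hln).ne_zero
  obtain ⟨B, β, γ, ι, hι, hB, hβγ, hγ, hint⟩ := exists_isPullback_fromNormalization
    (CommRingCat.ofHom φ) c (genericPointToProjLine m n l) hc
  have hmR : IsUnit (m : (ZLoc l)[X]) := by
    rw [← map_natCast C]
    exact (isUnit_natCast_zLoc hlm).map C
  obtain ⟨hflat, z, hz, hz'⟩ := faithfullyFlat_and_exists_eval₂_of_radical hφ hmR ha0 hirr hy hgen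
    (β := β.hom) (γ := γ.hom) (congr($(hβγ).hom)) hγ hint
  obtain ⟨T, Q, i₁, i₂, j₁, j₂, hT, hQ, hQdom, hj₁⟩ := exists_isPushout_isDomain_branchPoly
    (IsLocalRing.residue (ZLoc l)) hflat hn (natCast_residueField_zLoc_ne_zero hlm)
    (natCast_residueField_zLoc_ne_zero hln)
    (by exact_mod_cast natCast_residueField_zLoc_ne_zero hl3) hz hz'
  obtain ⟨v, hv⟩ := exists_isPullback_reductionDToProjLine hpow hspec hB hT hQ
  have hvimm : IsOpenImmersion v := MorphismProperty.of_isPullback hv.flip inferInstance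
  refine ⟨Spec Q, v, inferInstance, hvimm, ?_, ?_⟩
  · have h := IsOpenImmersion.image_preimage_eq_preimage_image_of_isPullback hv.flip ⊤
    have h := congr(($h : Set (reductionD m n l)))
    simpa using h
  · have hX : (mapRingHom (IsLocalRing.residue (ZLoc l))) X = X := by simp
    -- The generic point: k[t] injects into Q, so t is nonzero there and the point lies over the
    -- punctured line.
    let x : Spec Q := (⟨⊥, Ideal.isPrime_bot⟩ : PrimeSpectrum Q)
    have hx : Spec.map (β ≫ i₁ ≫ j₂) x ∈
        Set.range (PrimeSpectrum.comap (algebraMap (ZLoc l)[X] (LaurentPolynomial (ZLoc l)))) := by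
      rw [PrimeSpectrum.localization_away_comap_range (LaurentPolynomial (ZLoc l)) X]
      change (β ≫ i₁ ≫ j₂).hom X ∉ (⊥ : Ideal Q)
      have h1 : β ≫ i₁ ≫ j₂ = CommRingCat.ofHom (mapRingHom (IsLocalRing.residue (ZLoc l))) ≫ j₁ := by
        rw [hQ.w]
        rfl
      rw [h1, Ideal.mem_bot]
      change ¬ j₁.hom (mapRingHom (IsLocalRing.residue (ZLoc l)) X) = 0
      rw [hX, map_eq_zero_iff _ hj₁]
      exact X_ne_zero
    obtain ⟨z, hz⟩ := hx
    refine ⟨x, z, ?_⟩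
    rw [← Scheme.Hom.comp_apply, hv.w, Scheme.Hom.comp_apply, ← hz]
    rfl

/-- A scheme covered by two integral open subschemes with a common point is integral. -/
lemma isIntegral_of_two_openImmersions {X V W : Scheme.{0}} (v : V ⟶ X) (w : W ⟶ X)
    [IsOpenImmersion v] [IsOpenImmersion w] [IsIntegral V] [IsIntegral W]
    (hcover : Set.range v ∪ Set.range w = Set.univ)
    (hinter : (Set.range v ∩ Set.range w).Nonempty) : IsIntegral X := by
  have hred : IsReduced X := by
    have : ∀ x : X, _root_.IsReduced (X.presheaf.stalk x) := by
      intro x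
      have hx : x ∈ Set.range v ∪ Set.range w := hcover ▸ Set.mem_univ x
      rcases hx with ⟨y, rfl⟩ | ⟨y, rfl⟩
      · exact isReduced_of_injective (v.stalkMap y).hom
          (ConcreteCategory.bijective_of_isIso (v.stalkMap y)).1
      · exact isReduced_of_injective (w.stalkMap y).hom
          (ConcreteCategory.bijective_of_isIso (w.stalkMap y)).1
    exact isReduced_of_isReduced_stalk X
  obtain ⟨p, hpv, hpw⟩ := hinter
  have hirr : IrreducibleSpace X := by
    have hV : IsPreirreducible (Set.range v) := by
      rw [← Set.image_univ]
      exact (PreirreducibleSpace.isPreirreducible_univ (X := V)).image v v.continuous.continuousOn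
    have hW : IsPreirreducible (Set.range w) := by
      rw [← Set.image_univ]
      exact (PreirreducibleSpace.isPreirreducible_univ (X := W)).image w w.continuous.continuousOn
    -- The irreducible W meets the open V, so their intersection is dense in W.
    have hWV : Set.range w ⊆ closure (Set.range v) :=
      (subset_closure_inter_of_isPreirreducible_of_isOpen hW v.isOpenEmbedding.isOpen_range
        ⟨p, hpw, hpv⟩).trans (closure_mono Set.inter_subset_right)
    have hpre : IsPreirreducible (Set.univ : Set X) := by
      rw [← Set.univ_subset_iff.1 (hcover ▸ Set.union_subset subset_closure hWV)]
      exact hV.closure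
    exact { isPreirreducible_univ := hpre, toNonempty := ⟨p⟩ }
  exact isIntegral_of_irreducibleSpace_of_isReduced X

/-- The reduction of the divisor `𝒟` modulo a prime not dividing `3 * m * n` is integral. -/
theorem isIntegral_reductionD (hm0 : m ≠ 0) (hodd : Odd n) (hlm : ¬ l ∣ m) (hln : ¬ l ∣ n)
    (hl3 : ¬ l ∣ 3) : IsIntegral (reductionD m n l) := by
  have hdom := isDomain_affineCurveRing hm0 hodd
  have ht0 := coordT_ne_zero n hm0
  obtain ⟨V, v, hV, hv, hvr, x, z, hxz⟩ :=
    exists_isIntegral_openImmersion_reductionD m n l (c := chartZero (ZLoc l)) hodd hln hlm hl3 (chartZero_projLinePow _ _) (chartZero_toSpec _)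
    (coordToFunctionField_injective n l hm0) rfl (e := 0) (y := coordY m n)
    (by
      rw [coordY_pow, ← coordToFunctionField_X m n l]
      simp [branchPoly])
    (fun F hF hy ↦ subfield_eq_top m n F (coordToFunctionField_X m n l ▸ hF _) hy)
  obtain ⟨W, w, hW, hw, hwr, -⟩ :=
    exists_isIntegral_openImmersion_reductionD m n l (c := chartInfty (ZLoc l)) hodd hln hlm hl3 (chartInfty_projLinePow _ _) (chartInfty_toSpec _)
    (invCoordToFunctionField_injective m n l hm0) (genericPointToProjLine_eq_infty m n l hm0)
    -- With s = t⁻¹, (y s^n)^m = s^(nm) (s^(-n) + 1) = s^(n(m-1)) (s^n + 1).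
    (e := n * (m - 1)) (y := coordY m n * (coordT m n)⁻¹ ^ n)
    (by
      have h1 : coordT m n ^ n * (coordT m n)⁻¹ ^ n = 1 := by
        rw [← mul_pow, mul_inv_cancel₀ ht0, one_pow]
      have h2 : ((coordT m n)⁻¹ ^ n) ^ m = ((coordT m n)⁻¹ ^ n) ^ (m - 1) * (coordT m n)⁻¹ ^ n := by
        rw [← pow_succ, Nat.sub_add_cancel (Nat.pos_of_ne_zero hm0)]
      simp only [branchPoly, map_mul, map_pow, map_add, map_one, invCoordToFunctionField_X,
        mul_pow, coordY_pow]
      rw [h2, pow_mul]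
      linear_combination ((coordT m n)⁻¹ ^ n) ^ (m - 1) * h1)
    (fun F hF hy ↦ by
      have h1 : (coordT m n)⁻¹ ∈ F := invCoordToFunctionField_X m n l ▸ hF Polynomial.X
      have h2 : coordT m n ∈ F := inv_inv (coordT m n) ▸ inv_mem h1
      refine subfield_eq_top m n F h2 ?_
      have h3 := mul_mem hy (pow_mem h2 n)
      rwa [mul_assoc, ← mul_pow, inv_mul_cancel₀ ht0, one_pow, mul_one] at h3)
  refine isIntegral_of_two_openImmersions v w ?_ ?_
  · rw [hvr, hwr, ← Set.preimage_union, Set.eq_univ_iff_forall]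
    exact fun p ↦ charts_cover _ _
  · refine ⟨v x, ⟨x, rfl⟩, ?_⟩
    rw [hwr, Set.mem_preimage, hxz]
    exact ((charts_inter (ZLoc l)).symm.subset ⟨z, rfl⟩).2

end Reduction

end CyclicCover

theorem lemma2p4 (m n : ℕ) (hn : 5 ≤ n) (hn6 : Nat.Coprime n 6) (hm3 : Nat.Coprime m 3)
    (hmn : Nat.Coprime m n) (l : ℕ) [Fact l.Prime] (hl : ¬ l ∣ m * n) (hl3 : l ≠ 3) :
    AlgebraicGeometry.IsIntegral (CyclicCover.reductionD m n l) := by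
  have hm0 : m ≠ 0 := by rintro rfl; simp at hm3
  have hodd : Odd n := by
    rw [← Nat.coprime_two_right]
    exact hn6.coprime_dvd_right (by norm_num)
  exact CyclicCover.isIntegral_reductionD m n l hm0 hodd (fun h ↦ hl (h.mul_right n))
    (fun h ↦ hl (h.mul_left m))
    fun h ↦ hl3 ((Nat.prime_dvd_prime_iff_eq Fact.out Nat.prime_three).1 h)
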